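/- **Setting.** Write bicomplex numbers in the idempotent basis, $Z=z_1\mathbf e+z_2\mathbf e^\dagger$ with $z_\ell=x_\ell+\mathbf i y_\ell\in\mathbb C(\mathbf i)$; all operations are componentwise. Let $a_\ell<b_\ell$, $c_\ell<d_\ell$ $(\ell=1,2)$, $J_\ell=[a_\ell,b_\ell]+\mathbf i[c_\ell,d_\ell]$ and $J_P^Q=J_1\mathbf e+J_2\mathbf e^\dagger$. A product type function is $F(Z)=f_1(z_1)\mathbf e+f_2(z_2)\mathbf e^\dagger$. Fix the following data. * $\vec\alpha=(\alpha_0,\dots,\alpha_3)$ and $\vec\sigma=(\sigma_0,\dots,\sigma_3)$ in $(0,1)^4$, and $\sigma=(\sigma_0+\mathbf i\sigma_1)\mathbf e+(\sigma_2+\mathbf i\sigma_3)\mathbf e^\dagger$. * $\phi=\phi_1(z_1)\mathbf e+\phi_2(z_2)\mathbf e^\dagger$ with $\phi_\ell\in C^1(J_\ell,(0,\infty))$ and $\partial\phi_\ell/\partial x_\ell>0$, $\partial\phi_\ell/\partial y_\ell>0$ on $J_\ell$. Put $D\phi=\sum_{\ell}\big(\tfrac{\partial\phi_\ell}{\partial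 x_\ell}+\tfrac{\partial\phi_\ell}{\partial y_\ell}\big)\mathbf e_\ell$, where $\mathbf e_1=\mathbf e$, $\mathbf e_2=\mathbf e^\dagger$. * Weights $\vartheta=\vartheta_1(z_1)\mathbf e+\vartheta_2(z_2)\mathbf e^\dagger$ and $\varphi=\varphi_1(z_1)\mathbf e+\varphi_2(z_2)\mathbf e^\dagger$ with $\vartheta_\ell,\varphi_\ell\in C^1(\mathbb C,\mathbb C)$. Put $$\frac{\partial}{\partial Z_{\vartheta\varphi}}=\sum_\ell\Big(\vartheta_\ell\frac{\partial}{\partial x_\ell}+\varphi_\ell\frac{\partial}{\partial y_\ell}\Big)\mathbf e_\ell,\quad A_{\vartheta\varphi}=\sum_\ell\Big(\frac{\partial\,\Re\vartheta_\ell}{\partial x_\ell}+\frac{\partial\,\Re\varphi_\ell}{\partial y_\ell}\Big)\mathbf e_\ell,\quad B_{\vartheta\varphi}=\sum_\ell\Big(\frac{\partial\,\Im\vartheta_\ell}{\partial x_\ell}+\frac{\partial\,\Im\varphi_\ell}{\partial y_\ell}\Big)\mathbf e_\ell .$$ * $\lambda_\ell:J_\ell\to\mathbb R$, continuous on $J_\ell$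 and $C^1$ in its interior, such that $\frac{\partial}{\partial Z_{\vartheta\varphi}}(\lambda_1\mathbf e+\lambda_2\mathbf e^\dagger)=D\phi(Z)\,\sigma^{-1}(1-\sigma)$ in the interior of $J_P^Q$. Write $e^{\lambda}=e^{\lambda_1(z_1)}\mathbf e+e^{\lambda_2(z_2)}\mathbf e^\dagger$. For $\beta>0$, $0<s<1$ and a real $C^1$ function $\psi$ with $\psi'>0$, let $$(I^{\beta,s,\psi}_{a^+}f)(t)=\frac1{s^{\beta}\,\Gamma(\beta)}\int_a^t e^{\frac{s-1}{s}(\psi(t)-\psi(\tau))}(\psi(t)-\psi(\tau))^{\beta-1}f(\tau)\psi'(\tau)\,d\tau .$$ For $W=w_1\mathbf e+w_2\mathbf e^\dagger\in J_P^Q$ define $$\begin{aligned}I_{a^+}^{1-\vec\alpha,\vec\sigma,\phi}F(Z,W)=&\big(I^{1-\alpha_0,\sigma_0,\phi_1(\cdot+\mathbf i\Im w_1)}_{a_1^+}[f_1(\cdot+\mathbf i\Im w_1)](x_1)+I^{1-\alpha_1,\sigma_1,\phi_1(\Re w_1+\mathbf i\,\cdot)}_{c_1^+}[f_1(\Re w_1+\mathbf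 i\,\cdot)](y_1)\big)\mathbf e\\&+\big(I^{1-\alpha_2,\sigma_2,\phi_2(\cdot+\mathbf i\Im w_2)}_{a_2^+}[f_2(\cdot+\mathbf i\Im w_2)](x_2)+I^{1-\alpha_3,\sigma_3,\phi_2(\Re w_2+\mathbf i\,\cdot)}_{c_2^+}[f_2(\Re w_2+\mathbf i\,\cdot)](y_2)\big)\mathbf e^\dagger,\end{aligned}$$ $$\frac{\partial^{\vec\alpha,\sigma,\phi}F(Z,W)}{\partial Z_{\vartheta\varphi,a^+}}=(1-\sigma)\,I_{a^+}^{1-\vec\alpha,\vec\sigma,\phi}F(Z,W)+\sigma\,\frac{\frac{\partial}{\partial Z_{\vartheta\varphi}}I_{a^+}^{1-\vec\alpha,\vec\sigma,\phi}F(Z,W)}{D\phi(Z)} .$$ Let $\Lambda\subset J_P^Q$ be a surface with boundary $\gamma$, parametrized by $R=R_1\mathbf e+R_2\mathbf e^\dagger$ over the closed unit disc, where each $R_\ell$ is a homeomorphism onto a closed simply connected domain $\Lambda_\ell\subset\mathbb C(\mathbf i)$ whose boundary $\gamma_\ell$, parametrized by the restriction of $R_\ell$ to the unit circle, is a positively oriented,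 piecewise smooth, closed Jordan curve. For a product type function $G=G_1\mathbf e+G_2\mathbf e^\dagger$ put $$\int_\gamma G\,d\rho_{\vartheta\varphi}=\sum_\ell\mathbf e_\ell\int_{\gamma_\ell}G_\ell\,(\vartheta_\ell\,dy_\ell-\varphi_\ell\,dx_\ell),\qquad \int_\Lambda G\,dZ\wedge dZ^*=\sum_\ell\mathbf e_\ell\int_{\Lambda_\ell}G_\ell\,dz_\ell\wedge d\bar z_\ell,\qquad dz_\ell\wedge d\bar z_\ell=-2\mathbf i\,dx_\ell\,dy_\ell .$$ **Theorem.** Let $W\in J_P^Q$ be fixed and let $F=f_1\mathbf e+f_2\mathbf e^\dagger$ be a product type function on $J_P^Q$ such that $x_\ell\mapsto f_\ell(x_\ell+\mathbf i\Im w_\ell)$ and $y_\ell\mapsto f_\ell(\Re w_\ell+\mathbf iy_\ell)$ are absolutely continuous on $[a_\ell,b_\ell]$ and $[c_\ell,d_\ell]$, $\ell=1,2$. Suppose that $e^{\lambda}\,I_{a^+}^{1-\vec\alpha,\vec\sigma,\phi}F(\cdot,W)$ is of class $C^1$ in the interior of $J_P^Q$ and continuous on $J_P^Q$. Then the integrals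 below converge absolutely and $$\begin{aligned}\int_\gamma e^{\lambda}\,I_{a^+}^{1-\vec\alpha,\vec\sigma,\phi}F(Z,W)\,d\rho_{\vartheta\varphi}(Z)=\frac{\mathbf i}{2}\int_\Lambda\Big[&e^{\lambda}\,D\phi(Z)\,\sigma^{-1}\,\frac{\partial^{\vec\alpha,\sigma,\phi}F(Z,W)}{\partial Z_{\vartheta\varphi,a^+}}+A_{\vartheta\varphi}\,e^{\lambda}\,I_{a^+}^{1-\vec\alpha,\vec\sigma,\phi}F(Z,W)\\&+B_{\vartheta\varphi}\,\mathbf i\,e^{\lambda}\,I_{a^+}^{1-\vec\alpha,\vec\sigma,\phi}F(Z,W)\Big]\,dZ\wedge dZ^* .\end{aligned}$$ -/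

import Mathlib

open Set MeasureTheory
open scoped Real

noncomputable section

namespace BicomplexGauss

/-! ### Bicomplex numbers -/

/-- Bicomplex numbers in idempotent coordinates: `(z₁, z₂)` stands for `z₁ e + z₂ e†`, with
`z₁, z₂ ∈ ℂ(i)`. The ring operations (and the inverse of elements with nonzero coordinates) are
componentwise. -/
abbrev Bicomplex : Type := ℂ × ℂ

/-- The imaginary unit `i`. -/
def unitI : Bicomplex := (Complex.I, Complex.I)

/-- The imaginary unit `j`. -/
def unitJ : Bicomplex := (-Complex.I, Complex.I)

/-- The hyperbolic unit `k = i j`. -/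
def unitK : Bicomplex := unitI * unitJ

/-- The idempotent `e = (1 + k) / 2`. -/
def idemE : Bicomplex := (1 / 2 : ℂ) • (1 + unitK)

/-- The idempotent `e† = (1 - k) / 2`. -/
def idemEDag : Bicomplex := (1 / 2 : ℂ) • (1 - unitK)

theorem unitI_mul_unitI : unitI * unitI = -1 := by
  ext <;> simp [unitI]

theorem unitJ_mul_unitJ : unitJ * unitJ = -1 := by
  ext <;> simp [unitJ]

theorem unitK_eq : unitK = (1, -1) := by
  ext <;> simp [unitK, unitI, unitJ]

theorem idemE_eq : idemE = (1, 0) := by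
  ext
  · simp [idemE, unitK_eq]; norm_num
  · simp [idemE, unitK_eq]

theorem idemEDag_eq : idemEDag = (0, 1) := by
  ext
  · simp [idemEDag, unitK_eq]
  · simp [idemEDag, unitK_eq]; norm_num

/-- `(z₁, z₂)` is `z₁ e + z₂ e†`, where `z ∈ ℂ(i)` is embedded in `𝔹ℂ` as `(z, z)`. -/
theorem idempotent_repr (z₁ z₂ : ℂ) :
    ((z₁, z₂) : Bicomplex) = (z₁, z₁) * idemE + (z₂, z₂) * idemEDag := by
  rw [idemE_eq, idemEDag_eq]
  ext <;> simp

/-! ### Product type functions -/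

/-- A product type function `Z ↦ f₁(z₁) e + f₂(z₂) e†`, given by its components `(f₁, f₂)`. The
algebraic operations are the pointwise ones. -/
abbrev ProductFun : Type := (ℂ → ℂ) × (ℂ → ℂ)

/-- The value `f₁(z₁) e + f₂(z₂) e†` of a product type function at `Z = z₁ e + z₂ e†`. -/
def ProductFun.eval (F : ProductFun) (Z : Bicomplex) : Bicomplex := (F.1 Z.1, F.2 Z.2)

/-- A product type function with real components, `Z ↦ f₁(z₁) e + f₂(z₂) e†` with values in the
hyperbolic numbers. -/
abbrev RealProductFun : Type := (ℂ → ℝ) × (ℂ → ℝ)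

/-- A hyperbolic-valued product type function seen as a bicomplex-valued one. -/
def RealProductFun.toBicomplex (f : RealProductFun) : ProductFun :=
  (fun z => (f.1 z : ℂ), fun z => (f.2 z : ℂ))

/-- The constant function with bicomplex value `c`. -/
def constFun (c : Bicomplex) : ProductFun := (fun _ => c.1, fun _ => c.2)

/-- `e^{l₁} e + e^{l₂} e†`. -/
def expFun (l : RealProductFun) : ProductFun :=
  (fun z => (Real.exp (l.1 z) : ℂ), fun z => (Real.exp (l.2 z) : ℂ))

/-! ### The box -/

/-- The closed rectangle `[Re p, Re q] + i [Im p, Im q]`. -/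
def rect (p q : ℂ) : Set ℂ := {z | z.re ∈ Icc p.re q.re ∧ z.im ∈ Icc p.im q.im}

/-- The box `J_P^Q`, where `P = (a₁ + i c₁) e + (a₂ + i c₂) e†` and
`Q = (b₁ + i d₁) e + (b₂ + i d₂) e†` carry the corners of the two rectangles. -/
def box (P Q : Bicomplex) : Set Bicomplex := rect P.1 Q.1 ×ˢ rect P.2 Q.2

/-! ### Differential operators -/

/-- `∂g/∂x` at `z = x + i y`, for a function on the set `s` (one-sided at an edge of `s`). -/
def partialX {E : Type*} [NormedAddCommGroup E] [NormedSpace ℝ E]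
    (s : Set ℂ) (g : ℂ → E) (z : ℂ) : E :=
  lineDerivWithin ℝ g s z 1

/-- `∂g/∂y` at `z = x + i y`, for a function on the set `s` (one-sided at an edge of `s`). -/
def partialY {E : Type*} [NormedAddCommGroup E] [NormedSpace ℝ E]
    (s : Set ℂ) (g : ℂ → E) (z : ℂ) : E :=
  lineDerivWithin ℝ g s z Complex.I

/-- The bicomplex `(θ, ν)`-weighted Cauchy-Riemann operator
`(θ₁ ∂/∂x₁ + ν₁ ∂/∂y₁) e + (θ₂ ∂/∂x₂ + ν₂ ∂/∂y₂) e†` on product type functions on the box. -/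
def weightedCR (P Q : Bicomplex) (θ ν F : ProductFun) : ProductFun :=
  (fun z => θ.1 z * partialX (rect P.1 Q.1) F.1 z + ν.1 z * partialY (rect P.1 Q.1) F.1 z,
   fun z => θ.2 z * partialX (rect P.2 Q.2) F.2 z + ν.2 z * partialY (rect P.2 Q.2) F.2 z)

/-- `Dφ = (∂φ₁/∂x₁ + ∂φ₁/∂y₁) e + (∂φ₂/∂x₂ + ∂φ₂/∂y₂) e†`. -/
def gradSum (P Q : Bicomplex) (φ : RealProductFun) : ProductFun :=
  RealProductFun.toBicomplex
    (fun z => partialX (rect P.1 Q.1) φ.1 z + partialY (rect P.1 Q.1) φ.1 z,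
     fun z => partialX (rect P.2 Q.2) φ.2 z + partialY (rect P.2 Q.2) φ.2 z)

/-- `A_{θν}`: in each coordinate `∂ Re θ_ℓ/∂x_ℓ + ∂ Re ν_ℓ/∂y_ℓ`. -/
def weightA (θ ν : ProductFun) : ProductFun :=
  RealProductFun.toBicomplex
    (fun z => partialX univ (fun u => (θ.1 u).re) z + partialY univ (fun u => (ν.1 u).re) z,
     fun z => partialX univ (fun u => (θ.2 u).re) z + partialY univ (fun u => (ν.2 u).re) z)

/-- `B_{θν}`: in each coordinate `∂ Im θ_ℓ/∂x_ℓ + ∂ Im ν_ℓ/∂y_ℓ`. -/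
def weightB (θ ν : ProductFun) : ProductFun :=
  RealProductFun.toBicomplex
    (fun z => partialX univ (fun u => (θ.1 u).im) z + partialY univ (fun u => (ν.1 u).im) z,
     fun z => partialX univ (fun u => (θ.2 u).im) z + partialY univ (fun u => (ν.2 u).im) z)

/-! ### Proportional fractional integrals with respect to a function -/

/-- The left proportional fractional integral of order `β` and proportion `s`, based at `a`, of `f`
with respect to `φ`:
`(s^β Γ(β))⁻¹ ∫_a^t e^{((s-1)/s)(φ(t)-φ(τ))} (φ(t)-φ(τ))^{β-1} f(τ) φ'(τ) dτ`. -/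
def propFracIntegral (a β s : ℝ) (φ : ℝ → ℝ) (f : ℝ → ℂ) (t : ℝ) : ℂ :=
  ((1 / (s ^ β * Real.Gamma β) : ℝ) : ℂ) *
    ∫ τ in a..t,
      ((Real.exp ((s - 1) / s * (φ t - φ τ)) * (φ t - φ τ) ^ (β - 1) : ℝ) : ℂ) * f τ *
        ((deriv φ τ : ℝ) : ℂ)

/-- One coordinate of the bicomplex fractional integral: the sum of the one-variable integrals of
`x ↦ f(x + i Im w)`, based at `Re p`, and of `y ↦ f(Re w + i y)`, based at `Im p`. -/
def fracIntegralCoord (p : ℂ) (β₀ β₁ s₀ s₁ : ℝ) (φ : ℂ → ℝ) (f : ℂ → ℂ) (w z : ℂ) : ℂ :=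
  propFracIntegral p.re β₀ s₀ (fun t => φ ⟨t, w.im⟩) (fun t => f ⟨t, w.im⟩) z.re +
    propFracIntegral p.im β₁ s₁ (fun t => φ ⟨w.re, t⟩) (fun t => f ⟨w.re, t⟩) z.im

/-- `Z ↦ (I_{a⁺}^{1-α,σ,φ} F)(Z, W)`, as a product type function of `Z`. -/
def fracIntegral (P : Bicomplex) (α σ : Fin 4 → ℝ) (φ : RealProductFun) (F : ProductFun)
    (W : Bicomplex) : ProductFun :=
  (fracIntegralCoord P.1 (1 - α 0) (1 - α 1) (σ 0) (σ 1) φ.1 F.1 W.1,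
   fracIntegralCoord P.2 (1 - α 2) (1 - α 3) (σ 2) (σ 3) φ.2 F.2 W.2)

/-- The bicomplex number `σ = (σ₀ + i σ₁) e + (σ₂ + i σ₃) e†`. -/
def proportion (σ : Fin 4 → ℝ) : Bicomplex := (⟨σ 0, σ 1⟩, ⟨σ 2, σ 3⟩)

/-- The bicomplex weighted proportional fractional Cauchy-Riemann type operator
`(1 - σ) (I F)(Z, W) + σ (∂(I F)(Z, W)/∂Z_{θν}) / Dφ(Z)` with `I = I_{a⁺}^{1-α,σ,φ}`, as a product
type function of `Z`. -/
def fracCR (P Q : Bicomplex) (α σ : Fin 4 → ℝ) (φ : RealProductFun) (θ ν F : ProductFun)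
    (W : Bicomplex) : ProductFun :=
  constFun (1 - proportion σ) * fracIntegral P α σ φ F W +
    constFun (proportion σ) *
      (weightedCR P Q θ ν (fracIntegral P α σ φ F W) / gradSum P Q φ)

/-- The class `AC¹(J_P^Q, 𝔹ℂ)` relative to `W`: the slices of the two components of `F` through `W`
are absolutely continuous. -/
def IsAC (P Q W : Bicomplex) (F : ProductFun) : Prop :=
  AbsolutelyContinuousOnInterval (fun x => F.1 ⟨x, W.1.im⟩) P.1.re Q.1.re ∧
  AbsolutelyContinuousOnInterval (fun y => F.1 ⟨W.1.re, y⟩) P.1.im Q.1.im ∧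
  AbsolutelyContinuousOnInterval (fun x => F.2 ⟨x, W.2.im⟩) P.2.re Q.2.re ∧
  AbsolutelyContinuousOnInterval (fun y => F.2 ⟨W.2.re, y⟩) P.2.im Q.2.im

/-! ### Surfaces with boundary and integration -/

/-- `r` is piecewise `C¹` on `[a, b]`: there is a finite partition such that `r` is `C¹`, up to the
end points, on each closed piece. -/
def IsPiecewiseC1 (r : ℝ → ℂ) (a b : ℝ) : Prop :=
  ∃ (n : ℕ) (t : ℕ → ℝ), Monotone t ∧ t 0 = a ∧ t n = b ∧
    ∀ k < n, ContDiffOn ℝ 1 r (Icc (t k) (t (k + 1)))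

/-- The boundary curve `τ ↦ ρ(e^{iτ})`, `0 ≤ τ ≤ 2π`, of a map `ρ` of the closed unit disc. -/
def boundaryCurve (ρ : ℂ → ℂ) (τ : ℝ) : ℂ := ρ (Complex.exp (τ * Complex.I))

/-- The winding number of the closed curve `τ ↦ r(τ)`, `0 ≤ τ ≤ 2π`, about `z`. -/
def windingNumber (r : ℝ → ℂ) (z : ℂ) : ℂ :=
  (2 * π * Complex.I)⁻¹ * ∫ τ in (0 : ℝ)..(2 * π), deriv r τ / (r τ - z)

/-- `ρ` parametrizes, by the closed unit disc, a closed simply connected plane domain whose boundary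
is a positively oriented piecewise smooth closed Jordan curve: `ρ` is a homeomorphism onto its image,
its boundary curve is piecewise `C¹`, and that curve winds once, counterclockwise, about each point
of the image that is not on the curve. -/
structure IsPlaneParam (ρ : ℂ → ℂ) : Prop where
  continuousOn : ContinuousOn ρ (Metric.closedBall 0 1)
  injOn : InjOn ρ (Metric.closedBall 0 1)
  piecewise : IsPiecewiseC1 (boundaryCurve ρ) 0 (2 * π)
  positive : ∀ z ∈ ρ '' Metric.closedBall 0 1 \ ρ '' Metric.sphere 0 1,
    windingNumber (boundaryCurve ρ) z = 1

/-- A surface `Λ` in `𝔹ℂ` with boundary `γ`, parametrized by `R = R₁ e + R₂ e†` over the closed unit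
disc (parameters `u + i v`), where `R_ℓ` parametrizes a simply connected domain `Λ_ℓ` with piecewise
smooth Jordan boundary `γ_ℓ`; `γ` is parametrized by the restriction of `R` to the unit circle. -/
structure Surface where
  R : ℂ → Bicomplex
  param₁ : IsPlaneParam (fun q => (R q).1)
  param₂ : IsPlaneParam (fun q => (R q).2)

namespace Surface

/-- The surface `Λ` as a set (boundary included). -/
def carrier (S : Surface) : Set Bicomplex := S.R '' Metric.closedBall 0 1

/-- The plane domain `Λ₁` (boundary included). -/
def carrier₁ (S : Surface) : Set ℂ := (fun q => (S.R q).1) '' Metric.closedBall 0 1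

/-- The plane domain `Λ₂` (boundary included). -/
def carrier₂ (S : Surface) : Set ℂ := (fun q => (S.R q).2) '' Metric.closedBall 0 1

/-- The parametrization `r₁` of `γ₁`. -/
def curve₁ (S : Surface) : ℝ → ℂ := boundaryCurve (fun q => (S.R q).1)

/-- The parametrization `r₂` of `γ₂`. -/
def curve₂ (S : Surface) : ℝ → ℂ := boundaryCurve (fun q => (S.R q).2)

end Surface

/-- `f · dρ_{θν}`, with `dρ_{θν} = θ dy - ν dx`, pulled back along the curve `r`. -/
def rhoPullback (θ ν f : ℂ → ℂ) (r : ℝ → ℂ) (τ : ℝ) : ℂ :=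
  f (r τ) * (θ (r τ) * ((deriv r τ).im : ℂ) - ν (r τ) * ((deriv r τ).re : ℂ))

/-- `∫_γ G dρ_{θν} = e ∫_{γ₁} G₁ dρ_{θ₁ν₁} + e† ∫_{γ₂} G₂ dρ_{θ₂ν₂}`. -/
def lineIntegral (S : Surface) (θ ν G : ProductFun) : Bicomplex :=
  (∫ τ in (0 : ℝ)..(2 * π), rhoPullback θ.1 ν.1 G.1 S.curve₁ τ,
   ∫ τ in (0 : ℝ)..(2 * π), rhoPullback θ.2 ν.2 G.2 S.curve₂ τ)

/-- The two integrals in `lineIntegral` converge absolutely. -/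
def LineIntegrable (S : Surface) (θ ν G : ProductFun) : Prop :=
  IntervalIntegrable (rhoPullback θ.1 ν.1 G.1 S.curve₁) volume 0 (2 * π) ∧
  IntervalIntegrable (rhoPullback θ.2 ν.2 G.2 S.curve₂) volume 0 (2 * π)

/-- `∫_Λ G dZ ∧ dZ^* = e ∫_{Λ₁} G₁ dz₁ ∧ dz̄₁ + e† ∫_{Λ₂} G₂ dz₂ ∧ dz̄₂`, where
`dz ∧ dz̄ = -2i dx ∧ dy`. -/
def surfaceIntegral (S : Surface) (G : ProductFun) : Bicomplex :=
  (-2 * Complex.I * ∫ z in S.carrier₁, G.1 z, -2 * Complex.I * ∫ z in S.carrier₂, G.2 z)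

/-- The two integrals in `surfaceIntegral` converge absolutely. -/
def SurfaceIntegrable (S : Surface) (G : ProductFun) : Prop :=
  IntegrableOn G.1 S.carrier₁ ∧ IntegrableOn G.2 S.carrier₂

end BicomplexGauss

end

namespace BicomplexGauss

open Filter Topology

/-! ### Piecewise smooth curves -/

/-! The idempotent coordinates decouple, and `(i/2)(-2i) = 1`, so the claim is a divergence theorem
on each plane domain. Write `g` for a coordinate of the fractional integral, `H = e^λ g`, and `m`
for the coordinate of `σ`. The field is `(H ϑ, H φ)` with the two weights as factors. Its divergence
has three parts: the weighted derivative of `λ`, which the equation for `λ` turns into `Dφ m⁻¹(1 -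
m)`, times `H`; then `e^λ` times the weighted derivative of `g`; then `(A + iB) H`. The first two
parts combine to `e^λ Dφ m⁻¹` times the fractional operator (`gauss_coordinate`).

The divergence theorem for a Jordan domain comes from winding numbers. Integrating the
Cauchy–Pompeiu formula along the boundary curve and exchanging integrals gives `∫ f dz = i ∫ (∂f/∂x
+ i ∂f/∂y) n(z)`, where `n` is the winding number (`IsC1Curve.integral_mul_deriv`). Here `n` is `1`
inside by orientation, `0` outside because the curve extends over the disc
(`windingNumber_eq_zero`), and the curve itself is a null set.

The domain may touch the edge of the rectangle, where `H` is only continuous. Shrinking towards an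
interior point of the rectangle and passing to the limit (`integral_fluxPullback_of_continuousOn`)
requires the divergence to be integrable on the rectangle. The gradient of `λ` enters only through
its equation, hence boundedly. Moreover `g` is a function of `x` plus a function of `y`, each of
bounded variation: after the substitution by the kernel function it is a convolution of an
integrable kernel with a function of bounded variation (`boundedVariationOn_propFracIntegral`). So
the partial derivatives of `g` are integrable. -/

theorem IsPiecewiseC1.exists_finite_deriv_bound {r : ℝ → ℂ} {a b : ℝ} (h : IsPiecewiseC1 r a b) :
    ∃ S : Set ℝ, S.Finite ∧ ∃ M : ℝ, ∀ τ ∈ Ioo a b \ S,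
      DifferentiableAt ℝ r τ ∧ ‖deriv r τ‖ ≤ M := by
  obtain ⟨n, t, ht, h0, hn, hr⟩ := h
  have key : ∀ k, ∃ M : ℝ, 0 ≤ M ∧ (k < n → ∀ τ ∈ Ioo (t k) (t (k + 1)),
      DifferentiableAt ℝ r τ ∧ ‖deriv r τ‖ ≤ M) := by
    intro k
    by_cases hk : k < n ∧ t k < t (k + 1)
    · have hc := (hr k hk.1).continuousOn_derivWithin (uniqueDiffOn_Icc hk.2) le_rfl
      obtain ⟨M, hM⟩ := isCompact_Icc.exists_bound_of_continuousOn hc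
      refine ⟨max M 0, le_max_right _ _, fun _ τ hτ => ?_⟩
      have hn' : Icc (t k) (t (k + 1)) ∈ 𝓝 τ := Icc_mem_nhds hτ.1 hτ.2
      refine ⟨((hr k hk.1).differentiableOn one_ne_zero).differentiableAt hn', ?_⟩
      rw [← derivWithin_of_mem_nhds hn']
      exact (hM τ ⟨hτ.1.le, hτ.2.le⟩).trans (le_max_left _ _)
    · exact ⟨0, le_rfl, fun hkn τ hτ => absurd ⟨hkn, hτ.1.trans hτ.2⟩ hk⟩
  choose M hM0 hM using key
  refine ⟨t '' Iic n, (finite_Iic n).image t, ∑ k ∈ Finset.range n, M k, fun τ hτ => ?_⟩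
  obtain ⟨⟨haτ, hτb⟩, hτS⟩ := hτ
  classical
  -- The first node not below `τ` is the right end of the piece containing `τ`; equality is excluded
  -- because the nodes were put into the exceptional set.
  have hex : ∃ j, τ ≤ t j := ⟨n, hn ▸ hτb.le⟩
  obtain ⟨j, hj⟩ : ∃ j, Nat.find hex = j := ⟨_, rfl⟩
  have hspec : τ ≤ t j := hj ▸ Nat.find_spec hex
  have hjn : j ≤ n := hj ▸ Nat.find_min' hex (hn ▸ hτb.le)
  cases j with
  | zero => exact absurd hspec (by rw [h0]; exact not_le.2 haτ)
  | succ k =>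
    have hk : t k < τ := not_le.1 (Nat.find_min hex (by omega))
    have hk' : τ < t (k + 1) :=
      lt_of_le_of_ne hspec fun e => hτS ⟨k + 1, hjn, e.symm⟩
    obtain ⟨h1, h2⟩ := hM k (by omega) τ ⟨hk, hk'⟩
    exact ⟨h1, h2.trans
      (Finset.single_le_sum (fun i _ => hM0 i) (Finset.mem_range.2 (by omega)))⟩

/-- Differentiable maps between spaces of equal dimension preserve null sets, so the curve is viewed
as `r ∘ re` on the real axis, a null set of the plane. -/
theorem volume_image_curve_eq_zero {r : ℝ → ℂ} {a b : ℝ} {S : Set ℝ} (hS : S.Finite)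
    (h : ∀ τ ∈ Ioo a b \ S, DifferentiableAt ℝ r τ) : volume (r '' Icc a b) = 0 := by
  have h1 : volume (r '' (Ioo a b \ S)) = 0 := by
    have hl : volume {z : ℂ | z.im = 0} = 0 := by
      have := Measure.addHaar_submodule (volume : Measure ℂ) (LinearMap.ker Complex.imLm) (by
        intro ht
        have : Complex.I ∈ LinearMap.ker Complex.imLm := ht ▸ Submodule.mem_top
        simp at this)
      exact this
    have hs : volume {z : ℂ | z.im = 0 ∧ z.re ∈ Ioo a b \ S} = 0 :=
      measure_mono_null (fun z hz => hz.1) hl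
    refine measure_mono_null ?_ (addHaar_image_eq_zero_of_differentiableOn_of_addHaar_eq_zero
      (f := fun z : ℂ => r z.re) volume ?_ hs)
    · rintro _ ⟨τ, hτ, rfl⟩
      exact ⟨(τ : ℂ), ⟨by simp, by simpa using hτ⟩, by simp⟩
    · intro z hz
      exact ((h z.re hz.2).comp z Complex.reCLM.differentiableAt).differentiableWithinAt
  have h2 : volume (r '' (S ∪ {a, b})) = 0 :=
    ((hS.union (toFinite {a, b})).image r).measure_zero _
  refine measure_mono_null ?_ (measure_union_null h1 h2)
  rw [← image_union]
  refine image_mono fun τ hτ => ?_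
  by_cases hτS : τ ∈ S
  · exact Or.inr (Or.inl hτS)
  · rcases eq_or_lt_of_le hτ.1 with e | e
    · exact Or.inr (Or.inr (Or.inl e.symm))
    rcases eq_or_lt_of_le hτ.2 with e' | e'
    · exact Or.inr (Or.inr (Or.inr e'))
    exact Or.inl ⟨⟨e, e'⟩, hτS⟩

theorem ae_mem_Ioo_diff_finite {a b : ℝ} {S : Set ℝ} (hS : S.Finite) :
    ∀ᵐ τ, τ ∈ Ioc a b → τ ∈ Ioo a b \ S := by
  have h : volume (S ∪ {b}) = 0 := (hS.union (finite_singleton b)).measure_zero _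
  filter_upwards [compl_mem_ae_iff.2 h] with τ hτ hτ'
  simp only [mem_compl_iff, mem_union, mem_singleton_iff, not_or] at hτ
  exact ⟨⟨hτ'.1, lt_of_le_of_ne hτ'.2 hτ.2⟩, hτ.1⟩

/-- A continuous curve on `[0, 2π]` with bounded derivative off a finite set. -/
structure IsC1Curve (r : ℝ → ℂ) (S : Set ℝ) (M : ℝ) : Prop where
  continuous : Continuous r
  finite : S.Finite
  differentiableAt : ∀ τ ∈ Ioo 0 (2 * π) \ S, DifferentiableAt ℝ r τ
  norm_deriv_le : ∀ τ ∈ Ioo 0 (2 * π) \ S, ‖deriv r τ‖ ≤ M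

namespace IsC1Curve

variable {r : ℝ → ℂ} {S : Set ℝ} {M : ℝ}

theorem ae_norm_deriv_le (h : IsC1Curve r S M) :
    ∀ᵐ τ, τ ∈ Ioc 0 (2 * π) → ‖deriv r τ‖ ≤ M := by
  filter_upwards [ae_mem_Ioo_diff_finite (a := 0) (b := 2 * π) h.finite] with τ hτ hτ'
  exact h.norm_deriv_le τ (hτ hτ')

/-- The real-linear map `L` lets one statement cover `dz`, `dx` and `dy`. -/
theorem intervalIntegrable_mul_deriv (h : IsC1Curve r S M) {g : ℝ → ℂ}
    (hg : ContinuousOn g (Icc 0 (2 * π))) (L : ℂ →L[ℝ] ℂ) :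
    IntervalIntegrable (fun τ => g τ * L (deriv r τ)) volume 0 (2 * π) := by
  rw [intervalIntegrable_iff_integrableOn_Ioc_of_le Real.two_pi_pos.le]
  obtain ⟨C, hC⟩ := isCompact_Icc.exists_bound_of_continuousOn hg
  refine Integrable.of_bound ?_ (C * (‖L‖ * M)) ?_
  · exact ((hg.mono Ioc_subset_Icc_self).aestronglyMeasurable measurableSet_Ioc).mul
      (L.continuous.comp_aestronglyMeasurable (measurable_deriv r).aestronglyMeasurable)
  · rw [ae_restrict_iff' measurableSet_Ioc]
    filter_upwards [h.ae_norm_deriv_le] with τ hτ hτ'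
    rw [norm_mul]
    have h1 := hC τ (Ioc_subset_Icc_self hτ')
    have h2 := (L.le_opNorm (deriv r τ)).trans
      (mul_le_mul_of_nonneg_left (hτ hτ') (norm_nonneg L))
    exact mul_le_mul h1 h2 (norm_nonneg _) ((norm_nonneg _).trans h1)

theorem volume_image_eq_zero (h : IsC1Curve r S M) : volume (r '' Icc 0 (2 * π)) = 0 :=
  volume_image_curve_eq_zero h.finite h.differentiableAt

theorem isClosed_image (h : IsC1Curve r S M) : IsClosed (r '' Icc 0 (2 * π)) :=
  (isCompact_Icc.image h.continuous).isClosed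

theorem intervalIntegrable_winding (h : IsC1Curve r S M) {z : ℂ}
    (hz : z ∉ r '' Icc 0 (2 * π)) :
    IntervalIntegrable (fun τ => deriv r τ / (r τ - z)) volume 0 (2 * π) := by
  have := h.intervalIntegrable_mul_deriv (g := fun τ => (r τ - z)⁻¹)
    ((h.continuous.sub continuous_const).continuousOn.inv₀ fun τ hτ e =>
      hz ⟨τ, hτ, sub_eq_zero.1 e⟩) (ContinuousLinearMap.id ℝ ℂ)
  simpa [div_eq_inv_mul] using this

/-- Dominated convergence: if the curve avoids the `δ`-ball about `z`, all denominators stay above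
`δ / 2` for centres in the half ball. -/
theorem continuousAt_windingNumber (h : IsC1Curve r S M) {z : ℂ}
    (hz : z ∉ r '' Icc 0 (2 * π)) : ContinuousAt (windingNumber r) z := by
  obtain ⟨δ, hδ, hball⟩ := Metric.isOpen_iff.1 h.isClosed_image.isOpen_compl z hz
  have hM : ∀ w ∈ Metric.ball z (δ / 2), ∀ τ ∈ Icc 0 (2 * π), δ / 2 ≤ ‖r τ - w‖ := by
    intro w hw τ hτ
    by_contra hlt
    refine hball (a := r τ) ?_ ⟨τ, hτ, rfl⟩
    rw [Metric.mem_ball] at hw ⊢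
    have := dist_triangle (r τ) w z
    rw [dist_eq_norm (r τ) w] at this
    linarith [not_le.1 hlt]
  unfold windingNumber
  refine ContinuousAt.mul continuousAt_const ?_
  refine intervalIntegral.continuousAt_of_dominated_interval (bound := fun _ => M / (δ / 2))
    ?_ ?_ (by simp) ?_
  · refine Eventually.of_forall fun w => ?_
    exact ((measurable_deriv r).div (h.continuous.measurable.sub_const w)).aestronglyMeasurable
  · filter_upwards [Metric.ball_mem_nhds z (half_pos hδ)] with w hw
    rw [uIoc_of_le Real.two_pi_pos.le]
    filter_upwards [h.ae_norm_deriv_le] with τ hτ hτ'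
    rw [norm_div]
    exact div_le_div₀ ((norm_nonneg _).trans (hτ hτ')) (hτ hτ') (half_pos hδ)
      (hM w hw τ (Ioc_subset_Icc_self hτ'))
  · rw [uIoc_of_le Real.two_pi_pos.le]
    refine Eventually.of_forall fun τ hτ => ?_
    refine continuousAt_const.div (continuousAt_const.sub continuousAt_id) ?_
    exact fun e => hz ⟨τ, Ioc_subset_Icc_self hτ, sub_eq_zero.1 e⟩

/-- A closed curve for which `r - z` has a continuous logarithm does not wind about `z`. -/
theorem windingNumber_eq_zero_of_log (h : IsC1Curve r S M) {z : ℂ} {l : ℝ → ℂ}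
    (hl : Continuous l) (he : ∀ τ, Complex.exp (l τ) = r τ - z) (hclosed : l (2 * π) = l 0) :
    windingNumber r z = 0 := by
  have hne : ∀ τ, r τ - z ≠ 0 := fun τ => he τ ▸ Complex.exp_ne_zero _
  have hder : ∀ τ ∈ Ioo (min 0 (2 * π)) (max 0 (2 * π)) \ S,
      HasDerivAt l (deriv r τ / (r τ - z)) τ := by
    rw [min_eq_left Real.two_pi_pos.le, max_eq_right Real.two_pi_pos.le]
    intro τ hτ
    have hr : HasDerivAt (fun t => (r t - z) / (r τ - z)) (deriv r τ / (r τ - z)) τ :=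
      (((h.differentiableAt τ hτ).hasDerivAt).sub_const z).div_const _
    -- Dividing by the value at `τ` puts the argument of the logarithm at `1`, away from the branch
    -- cut.
    have hlog := hr.clog_real (by simp [div_self (hne τ)])
    simp only [div_self (hne τ), div_one] at hlog
    -- By continuity `l t - l τ` stays in the strip `|Im| < π`, where the principal logarithm
    -- inverts `exp`.
    have hev : ∀ᶠ t in 𝓝 τ, l t = l τ + Complex.log ((r t - z) / (r τ - z)) := by
      have hc : Continuous fun t => (l t - l τ).im := by fun_prop
      have : ∀ᶠ t in 𝓝 τ, |(l t - l τ).im| < π := by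
        refine (hc.abs.continuousAt (x := τ)).eventually_lt continuousAt_const ?_
        simp [Real.pi_pos]
      filter_upwards [this] with t ht
      rw [← he t, ← he τ, ← Complex.exp_sub, Complex.log_exp (abs_lt.1 ht).1 (abs_lt.1 ht).2.le]
      ring
    exact (hlog.const_add (l τ)).congr_of_eventuallyEq hev
  have hz : z ∉ r '' Icc 0 (2 * π) := by
    rintro ⟨τ, -, e⟩
    exact hne τ (sub_eq_zero.2 e)
  rw [windingNumber, integral_eq_of_hasDerivAt_off_countable l _ h.finite.countable
    hl.continuousOn hder (h.intervalIntegrable_winding hz), hclosed, sub_self, mul_zero]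

end IsC1Curve

/-! ### Plane domains parametrized by the disc -/

namespace IsPlaneParam

variable {ρ : ℂ → ℂ}

theorem exp_mem_sphere (τ : ℝ) : Complex.exp (τ * Complex.I) ∈ Metric.sphere (0 : ℂ) 1 := by
  simp [Complex.norm_exp_ofReal_mul_I]

theorem continuous_boundaryCurve (h : IsPlaneParam ρ) : Continuous (boundaryCurve ρ) :=
  h.continuousOn.comp_continuous (by fun_prop)
    fun τ => Metric.sphere_subset_closedBall (exp_mem_sphere τ)

theorem exists_isC1Curve (h : IsPlaneParam ρ) : ∃ S M, IsC1Curve (boundaryCurve ρ) S M := by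
  obtain ⟨S, hS, M, hM⟩ := h.piecewise.exists_finite_deriv_bound
  exact ⟨S, M, h.continuous_boundaryCurve, hS, fun τ hτ => (hM τ hτ).1, fun τ hτ => (hM τ hτ).2⟩

theorem image_boundaryCurve (ρ : ℂ → ℂ) :
    boundaryCurve ρ '' Icc 0 (2 * π) = ρ '' Metric.sphere 0 1 := by
  ext z
  constructor
  · rintro ⟨τ, -, rfl⟩
    exact ⟨_, exp_mem_sphere τ, rfl⟩
  · rintro ⟨q, hq, rfl⟩
    have hq1 : ‖q‖ = 1 := by simpa using hq
    have hexp : Complex.exp (q.arg * Complex.I) = q := by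
      simpa [hq1] using Complex.norm_mul_exp_arg_mul_I q
    rcases le_or_gt 0 q.arg with h0 | h0
    · refine ⟨q.arg, ⟨h0, by linarith [Complex.arg_le_pi q, Real.pi_pos]⟩, ?_⟩
      rw [boundaryCurve, hexp]
    · refine ⟨q.arg + 2 * π, ⟨by linarith [Complex.neg_pi_lt_arg q], by linarith⟩, ?_⟩
      rw [boundaryCurve]
      congr 1
      push_cast
      rw [add_mul, Complex.exp_add, Complex.exp_two_pi_mul_I, mul_one, hexp]

theorem isCompact_image (h : IsPlaneParam ρ) : IsCompact (ρ '' Metric.closedBall 0 1) :=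
  (isCompact_closedBall 0 1).image_of_continuousOn h.continuousOn

/-- The boundary curve of a parametrized domain does not wind about the points outside it. -/
theorem windingNumber_eq_zero (h : IsPlaneParam ρ) {z : ℂ}
    (hz : z ∉ ρ '' Metric.closedBall 0 1) : windingNumber (boundaryCurve ρ) z = 0 := by
  obtain ⟨S, M, hc⟩ := h.exists_isC1Curve
  -- Radial retraction of the plane onto the closed disc. It extends `ρ - z` to a nowhere vanishing
  -- map on the simply connected plane, which therefore lifts through `exp`.
  let π₁ : ℂ → ℂ := fun q => ((max 1 ‖q‖ : ℝ) : ℂ)⁻¹ * q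
  have hmax : ∀ q : ℂ, (0 : ℝ) < max 1 ‖q‖ := fun q => lt_max_of_lt_left one_pos
  have hπ₁ : ∀ q, π₁ q ∈ Metric.closedBall (0 : ℂ) 1 := by
    intro q
    simp only [π₁, mem_closedBall_zero_iff, norm_mul, norm_inv, Complex.norm_real,
      Real.norm_of_nonneg (hmax q).le]
    rw [inv_mul_le_iff₀ (hmax q), mul_one]
    exact le_max_right _ _
  have hπc : Continuous π₁ := by
    refine Continuous.mul (Continuous.inv₀ (by fun_prop) fun q => ?_) continuous_id
    exact_mod_cast (hmax q).ne'
  have hf : Continuous fun q => ρ (π₁ q) - z :=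
    (h.continuousOn.comp_continuous hπc hπ₁).sub continuous_const
  have hne : ∀ q, ρ (π₁ q) - z ≠ 0 := fun q e => hz ⟨π₁ q, hπ₁ q, sub_eq_zero.1 e⟩
  let f : C(ℂ, {w : ℂ // w ≠ 0}) := ⟨fun q => ⟨ρ (π₁ q) - z, hne q⟩, hf.subtype_mk hne⟩
  obtain ⟨L, ⟨-, hL⟩, -⟩ := Complex.isCoveringMap_exp.existsUnique_continuousMap_lifts f 0
    (Complex.log (ρ (π₁ 0) - z)) (Subtype.ext (Complex.exp_log (hne 0)))
  have hL' : ∀ q, Complex.exp (L q) = ρ (π₁ q) - z := fun q =>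
    congrArg Subtype.val (congrFun hL q)
  -- The logarithm is a function of `e^{iτ}`, so it returns to its initial value at `2π`.
  refine hc.windingNumber_eq_zero_of_log (l := fun τ => L (Complex.exp (τ * Complex.I)))
    (by fun_prop) (fun τ => ?_) (by simp [Complex.exp_two_pi_mul_I])
  rw [hL', boundaryCurve]
  simp [π₁, Complex.norm_exp_ofReal_mul_I]

/-- Takes the place of invariance of domain: the winding number is `1` here, continuous off the
curve, and `0` outside the image, so a nearby point cannot leave the image. -/
theorem isOpen_image_diff (h : IsPlaneParam ρ) :
    IsOpen (ρ '' Metric.closedBall 0 1 \ ρ '' Metric.sphere 0 1) := by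
  obtain ⟨S, M, hc⟩ := h.exists_isC1Curve
  rw [isOpen_iff_mem_nhds]
  intro z hz
  have hcl := hc.isClosed_image
  rw [image_boundaryCurve] at hcl
  have hcont := hc.continuousAt_windingNumber (z := z) (by rw [image_boundaryCurve]; exact hz.2)
  have hne : ∀ᶠ w in 𝓝 z, windingNumber (boundaryCurve ρ) w ≠ 0 :=
    hcont.eventually_ne (by rw [h.positive z hz]; exact one_ne_zero)
  filter_upwards [hne, hcl.isOpen_compl.mem_nhds hz.2] with w hw hw'
  exact ⟨by_contra fun hn => hw (h.windingNumber_eq_zero hn), hw'⟩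

theorem volume_image_sphere (h : IsPlaneParam ρ) : volume (ρ '' Metric.sphere 0 1) = 0 := by
  obtain ⟨S, M, hc⟩ := h.exists_isC1Curve
  rw [← image_boundaryCurve]
  exact hc.volume_image_eq_zero

end IsPlaneParam

/-! ### The Cauchy–Pompeiu formula for compactly supported functions -/

/-- `∂f/∂x + i ∂f/∂y`, twice the Wirtinger derivative `∂f/∂z̄`. -/
noncomputable def dbar (f : ℂ → ℂ) (z : ℂ) : ℂ :=
  fderiv ℝ f z 1 + Complex.I * fderiv ℝ f z Complex.I

section Pompeiu

variable {f : ℂ → ℂ}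

theorem continuous_dbar (hf : ContDiff ℝ 1 f) : Continuous (dbar f) := by
  have := hf.continuous_fderiv one_ne_zero
  unfold dbar
  fun_prop

theorem hasCompactSupport_dbar (hc : HasCompactSupport f) : HasCompactSupport (dbar f) := by
  refine (hc.fderiv ℝ).mono' fun z hz => ?_
  refine subset_tsupport _ fun h0 => hz ?_
  simp [dbar, h0]

/-- In polar coordinates `∂/∂x + i ∂/∂y = e^{iθ}(∂/∂r + (i/r) ∂/∂θ)`. The area factor `r` cancels
the singularity of `1/z`, leaving a radial and an angular derivative. -/
theorem polar_smul_dbar (r θ : ℝ) (hr : r ≠ 0) :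
    r • (dbar f (r * Complex.exp (θ * Complex.I)) / (r * Complex.exp (θ * Complex.I))) =
      fderiv ℝ f (r * Complex.exp (θ * Complex.I)) (Complex.exp (θ * Complex.I)) +
      Complex.I * fderiv ℝ f (r * Complex.exp (θ * Complex.I))
        (Complex.exp (θ * Complex.I) * Complex.I) := by
  have hr' : (r : ℂ) ≠ 0 := by exact_mod_cast hr
  set w := (r : ℂ) * Complex.exp (θ * Complex.I)
  set L := fderiv ℝ f w
  have he : Complex.exp (θ * Complex.I) = Real.cos θ • (1 : ℂ) + Real.sin θ • Complex.I := by
    rw [Complex.exp_mul_I]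
    simp
  have he' : Complex.exp (θ * Complex.I) * Complex.I =
      (-Real.sin θ) • (1 : ℂ) + Real.cos θ • Complex.I := by
    rw [he]
    simp only [Complex.real_smul, mul_one, Complex.ofReal_neg]
    linear_combination (Real.sin θ : ℂ) * Complex.I_mul_I
  have h1 : L (Complex.exp (θ * Complex.I)) = Real.cos θ * L 1 + Real.sin θ * L Complex.I := by
    rw [he, map_add, map_smul, map_smul, Complex.real_smul, Complex.real_smul]
  have h2 : L (Complex.exp (θ * Complex.I) * Complex.I) =
      -Real.sin θ * L 1 + Real.cos θ * L Complex.I := by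
    rw [he', map_add, map_smul, map_smul, Complex.real_smul, Complex.real_smul]
    simp
  rw [h1, h2, dbar, Complex.real_smul]
  change (r : ℂ) * ((L 1 + Complex.I * L Complex.I) / (r * Complex.exp (θ * Complex.I))) = _
  rw [mul_div_assoc', mul_div_mul_left _ _ hr', div_eq_iff (Complex.exp_ne_zero _), he]
  have hcs : (Real.cos θ : ℂ) ^ 2 + (Real.sin θ : ℂ) ^ 2 = 1 := by
    exact_mod_cast Real.cos_sq_add_sin_sq θ
  simp only [Complex.real_smul, mul_one]
  linear_combination (-L 1 - Complex.I * L Complex.I) * hcs +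
    ((Real.sin θ : ℂ) ^ 2 * L 1 - (Real.sin θ : ℂ) * Real.cos θ * L Complex.I) * Complex.I_mul_I

theorem integrableOn_polar (hf : ContDiff ℝ 1 f) (hc : HasCompactSupport f) {v : ℝ → ℂ}
    (hv : Continuous v) :
    IntegrableOn (fun p : ℝ × ℝ => fderiv ℝ f (p.1 * Complex.exp (p.2 * Complex.I)) (v p.2))
      (Ioi 0 ×ˢ Ioo (-π) π) := by
  obtain ⟨R, hR⟩ := (hc.fderiv (𝕜 := ℝ)).isCompact.isBounded.subset_closedBall (0 : ℂ)
  have hcont := hf.continuous_fderiv one_ne_zero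
  have h1 : IntegrableOn
      (fun p : ℝ × ℝ => fderiv ℝ f (p.1 * Complex.exp (p.2 * Complex.I)) (v p.2))
      (Icc 0 R ×ˢ Icc (-π) π) := by
    refine ContinuousOn.integrableOn_compact (isCompact_Icc.prod isCompact_Icc) ?_
    exact Continuous.continuousOn (by fun_prop)
  refine h1.of_forall_sdiff_eq_zero (measurableSet_Ioi.prod measurableSet_Ioo) fun p hp => ?_
  have hp0 : 0 < p.1 := hp.1.1
  -- Outside the compact box the radius exceeds that of the support, so the integrand vanishes
  -- there.
  have hpR : R < p.1 := by
    by_contra hle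
    exact hp.2 ⟨⟨hp0.le, not_lt.1 hle⟩, Ioo_subset_Icc_self hp.1.2⟩
  have : fderiv ℝ f (p.1 * Complex.exp (p.2 * Complex.I)) = 0 := by
    refine image_eq_zero_of_notMem_tsupport fun hmem => ?_
    have := hR hmem
    simp [Complex.norm_exp_ofReal_mul_I, abs_of_pos hp0] at this
    linarith
  rw [this]
  rfl

theorem integral_Ioi_radial (hf : ContDiff ℝ 1 f) (hc : HasCompactSupport f) (θ : ℝ) :
    ∫ r in Ioi (0 : ℝ), fderiv ℝ f (r * Complex.exp (θ * Complex.I)) (Complex.exp (θ * Complex.I))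
      = -f 0 := by
  set e := Complex.exp (θ * Complex.I)
  have he : ‖e‖ = 1 := Complex.norm_exp_ofReal_mul_I θ
  have hsm : ContDiff ℝ 1 fun r : ℝ => f (r * e) :=
    hf.comp (Complex.ofRealCLM.contDiff.mul contDiff_const)
  obtain ⟨R, hR⟩ := hc.isCompact.isBounded.subset_closedBall (0 : ℂ)
  have hcs : HasCompactSupport fun r : ℝ => f (r * e) := by
    refine HasCompactSupport.intro (isCompact_Icc (a := -R) (b := R)) fun r hr => ?_
    refine image_eq_zero_of_notMem_tsupport fun hmem => hr ?_
    have := hR hmem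
    rw [mem_closedBall_zero_iff, norm_mul, he, mul_one, Complex.norm_real] at this
    exact abs_le.1 this
  have := hcs.integral_Ioi_deriv_eq hsm 0
  simp only [Complex.ofReal_zero, zero_mul] at this
  rw [← this]
  refine integral_congr_ae (Eventually.of_forall fun r => ?_)
  have h1 : HasDerivAt (fun r : ℝ => (r : ℂ) * e) e r := by
    simpa using (Complex.ofRealCLM.hasDerivAt (x := r)).mul_const e
  exact ((hf.differentiable one_ne_zero _).hasFDerivAt.comp_hasDerivAt r h1).deriv.symm

/-- Up to the factor `r`, the integrand is the `θ`-derivative of a `2π`-periodic function. -/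
theorem integral_Ioo_angular (hf : ContDiff ℝ 1 f) {r : ℝ} (hr : r ≠ 0) :
    ∫ θ in Ioo (-π) π, fderiv ℝ f (r * Complex.exp (θ * Complex.I))
      (Complex.exp (θ * Complex.I) * Complex.I) = 0 := by
  have hcont := hf.continuous_fderiv one_ne_zero
  have hd : ∀ θ : ℝ, HasDerivAt (fun θ : ℝ => f (r * Complex.exp (θ * Complex.I)))
      (r • fderiv ℝ f (r * Complex.exp (θ * Complex.I))
      (Complex.exp (θ * Complex.I) * Complex.I)) θ := by
    intro θ
    have h1 : HasDerivAt (fun θ : ℝ => (r : ℂ) * Complex.exp (θ * Complex.I))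
        (r • (Complex.exp (θ * Complex.I) * Complex.I)) θ := by
      have h0 : HasDerivAt (fun θ : ℝ => (θ : ℂ) * Complex.I) Complex.I θ := by
        simpa using (Complex.ofRealCLM.hasDerivAt (x := θ)).mul_const Complex.I
      rw [Complex.real_smul]
      exact h0.cexp.const_mul _
    rw [← map_smul]
    exact (hf.differentiable one_ne_zero _).hasFDerivAt.comp_hasDerivAt θ h1
  have h2 : ∫ θ in (-π)..π, r • fderiv ℝ f (r * Complex.exp (θ * Complex.I))
      (Complex.exp (θ * Complex.I) * Complex.I) = 0 := by
    rw [intervalIntegral.integral_eq_sub_of_hasDerivAt (fun θ _ => hd θ)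
      (Continuous.intervalIntegrable (by fun_prop) _ _)]
    have : Complex.exp ((-π : ℝ) * Complex.I) = Complex.exp ((π : ℝ) * Complex.I) := by
      rw [Complex.exp_eq_exp_iff_exists_int]
      exact ⟨-1, by push_cast; ring⟩
    rw [this, sub_self]
  rw [intervalIntegral.integral_of_le (by linarith [Real.pi_pos]), integral_Ioc_eq_integral_Ioo,
    integral_smul] at h2
  exact (smul_eq_zero.1 h2).resolve_left hr

/-- Each ray contributes `-f 0` and each circle contributes nothing. The radial term is therefore
integrated first in `r`, which needs a swap, and the angular one first in `θ`. -/
theorem integral_dbar_div_self (hf : ContDiff ℝ 1 f) (hc : HasCompactSupport f) :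
    ∫ z, dbar f z / z = -(2 * π) * f 0 := by
  rw [← Complex.integral_comp_polarCoord_symm]
  have hi1 := integrableOn_polar hf hc (v := fun θ => Complex.exp (θ * Complex.I)) (by fun_prop)
  have hi2 := integrableOn_polar hf hc
    (v := fun θ => Complex.exp (θ * Complex.I) * Complex.I) (by fun_prop)
  have hsplit : ∫ p in polarCoord.target,
      p.1 • (dbar f (Complex.polarCoord.symm p) / Complex.polarCoord.symm p) =
      (∫ p in Ioi (0 : ℝ) ×ˢ Ioo (-π) π, fderiv ℝ f (p.1 * Complex.exp (p.2 * Complex.I))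
        (Complex.exp (p.2 * Complex.I))) +
      Complex.I * ∫ p in Ioi (0 : ℝ) ×ˢ Ioo (-π) π,
        fderiv ℝ f (p.1 * Complex.exp (p.2 * Complex.I))
          (Complex.exp (p.2 * Complex.I) * Complex.I) := by
    rw [← integral_const_mul, ← integral_add hi1 (hi2.const_mul _), polarCoord_target]
    refine setIntegral_congr_fun (measurableSet_Ioi.prod measurableSet_Ioo) fun p hp => ?_
    have hp0 : p.1 ≠ 0 := (show 0 < p.1 from hp.1).ne'
    have hpol : Complex.polarCoord.symm p = p.1 * Complex.exp (p.2 * Complex.I) := by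
      rw [Complex.polarCoord_symm_apply, Complex.exp_mul_I]
      push_cast
      rfl
    simp only [hpol]
    exact polar_smul_dbar p.1 p.2 hp0
  rw [hsplit]
  have e1 : ∫ p in Ioi (0 : ℝ) ×ˢ Ioo (-π) π, fderiv ℝ f (p.1 * Complex.exp (p.2 * Complex.I))
        (Complex.exp (p.2 * Complex.I)) = -(2 * π) * f 0 := by
    rw [Measure.volume_eq_prod] at hi1 ⊢
    have hsw := setIntegral_prod _ hi1.swap
    simp only [Function.comp_apply, Prod.fst_swap, Prod.snd_swap,
      integral_Ioi_radial hf hc] at hsw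
    rw [← setIntegral_prod_swap]
    simp only [Prod.fst_swap, Prod.snd_swap]
    rw [hsw]
    rw [setIntegral_const, measureReal_def, Real.volume_Ioo,
      ENNReal.toReal_ofReal (by linarith [Real.pi_pos]), Complex.real_smul]
    push_cast
    ring
  have e2 : ∫ p in Ioi (0 : ℝ) ×ˢ Ioo (-π) π, fderiv ℝ f (p.1 * Complex.exp (p.2 * Complex.I))
        (Complex.exp (p.2 * Complex.I) * Complex.I) = 0 := by
    rw [Measure.volume_eq_prod] at hi2 ⊢
    rw [setIntegral_prod _ hi2]
    refine setIntegral_eq_zero_of_forall_eq_zero fun r hr => ?_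
    exact integral_Ioo_angular hf (show 0 < r from hr).ne'
  rw [e1, e2, mul_zero, add_zero]

/-- The Cauchy–Pompeiu formula. -/
theorem integral_dbar_div_sub (hf : ContDiff ℝ 1 f) (hc : HasCompactSupport f) (ζ : ℂ) :
    ∫ z, dbar f z / (z - ζ) = -(2 * π) * f ζ := by
  have h := integral_dbar_div_self (f := fun z => f (ζ + z)) (hf.comp (by fun_prop))
    (hc.comp_homeomorph (Homeomorph.addLeft ζ))
  rw [← integral_add_left_eq_self _ ζ]
  simp only [add_zero, add_sub_cancel_left] at h ⊢
  rw [← h]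
  simp only [dbar, fderiv_comp_add_left]

/-- A majorant of the Cauchy kernel against a bounded integrable density. -/
theorem exists_cauchy_majorant (hf : ContDiff ℝ 1 f) (hc : HasCompactSupport f) :
    ∃ C : ℝ, ∀ ζ : ℂ, Integrable (fun z => dbar f z / (z - ζ)) ∧
      ∫ z, ‖dbar f z / (z - ζ)‖ ≤ C := by
  have hD := continuous_dbar hf
  have hDi := hD.integrable_of_hasCompactSupport (μ := volume) (hasCompactSupport_dbar hc)
  obtain ⟨B, hB⟩ := hD.bounded_above_of_compact_support (hasCompactSupport_dbar hc)
  -- The exponent `1` is below the dimension `2`.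
  have hk : IntegrableOn (fun z : ℂ => ‖z‖⁻¹) (Metric.ball 0 1) := by
    refine integrableOn_ball_of_norm_le_rpow (C := 1) (α := 1) ?_ ?_ ?_ ?_
    · rw [Complex.finrank_real_complex]; norm_num
    · rw [Complex.finrank_real_complex]; norm_num
    · refine Eventually.of_forall fun z => ?_
      simp [Real.rpow_neg_one]
    · exact (measurable_norm.inv).aestronglyMeasurable
  set k : ℂ → ℝ := (Metric.ball (0 : ℂ) 1).indicator fun z => ‖z‖⁻¹ with hkdef
  have hki : Integrable k := hk.integrable_indicator measurableSet_ball
  have hdom : ∀ ζ : ℂ, Integrable fun z => B * k (z - ζ) + ‖dbar f z‖ := fun ζ =>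
    ((hki.comp_sub_right ζ).const_mul B).add hDi.norm
  -- Within distance `1` of `ζ` the density is bounded by `B`; beyond it the kernel is at most `1`.
  -- Translation invariance makes the resulting bound independent of `ζ`.
  have hle : ∀ ζ z : ℂ, ‖dbar f z / (z - ζ)‖ ≤ B * k (z - ζ) + ‖dbar f z‖ := by
    intro ζ z
    have hB0 : 0 ≤ B := (norm_nonneg _).trans (hB z)
    rw [norm_div, div_eq_mul_inv]
    by_cases hz : z - ζ ∈ Metric.ball (0 : ℂ) 1
    · rw [hkdef, indicator_of_mem hz]
      have := mul_le_mul_of_nonneg_right (hB z) (inv_nonneg.2 (norm_nonneg (z - ζ)))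
      linarith [norm_nonneg (dbar f z)]
    · rw [hkdef, indicator_of_notMem hz, mul_zero, zero_add]
      refine mul_le_of_le_one_right (norm_nonneg _) (inv_le_one_of_one_le₀ ?_)
      simpa using hz
  have hint : ∀ ζ : ℂ, Integrable fun z => dbar f z / (z - ζ) := fun ζ =>
    (hdom ζ).mono' (hD.measurable.div (measurable_id.sub_const ζ)).aestronglyMeasurable
      (Eventually.of_forall (hle ζ))
  refine ⟨B * (∫ z, k z) + ∫ z, ‖dbar f z‖, fun ζ => ⟨hint ζ, ?_⟩⟩
  refine (integral_mono (hint ζ).norm (hdom ζ) (hle ζ)).trans_eq ?_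
  rw [integral_add ((hki.comp_sub_right ζ).const_mul B) hDi.norm, integral_const_mul,
    integral_sub_right_eq_self]

/-- The integral of a compactly supported `C¹` function along a closed curve, in terms of the winding
numbers of the curve. -/
theorem IsC1Curve.integral_mul_deriv {r : ℝ → ℂ} {S : Set ℝ} {M : ℝ} (h : IsC1Curve r S M)
    (hf : ContDiff ℝ 1 f) (hc : HasCompactSupport f) :
    ∫ τ in (0 : ℝ)..(2 * π), f (r τ) * deriv r τ =
      Complex.I * ∫ z, dbar f z * windingNumber r z := by
  obtain ⟨C, hC⟩ := exists_cauchy_majorant hf hc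
  have hpi : (2 * π : ℂ) ≠ 0 := by
    exact_mod_cast Real.two_pi_pos.ne'
  have hmeas : AEStronglyMeasurable (Function.uncurry fun (τ : ℝ) (z : ℂ) =>
      dbar f z / (z - r τ) * deriv r τ) ((volume.restrict (Ioc 0 (2 * π))).prod volume) := by
    refine Measurable.aestronglyMeasurable ?_
    have h1 := (continuous_dbar hf).measurable
    have h2 := h.continuous.measurable
    have h3 := measurable_deriv r
    unfold Function.uncurry
    fun_prop
  have hint : Integrable (Function.uncurry fun (τ : ℝ) (z : ℂ) =>
      dbar f z / (z - r τ) * deriv r τ) ((volume.restrict (Ioc 0 (2 * π))).prod volume) := by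
    rw [integrable_prod_iff hmeas]
    refine ⟨Eventually.of_forall fun τ => (hC (r τ)).1.mul_const (deriv r τ), ?_⟩
    refine Integrable.of_bound hmeas.norm.integral_prod_right' (C * M) ?_
    rw [ae_restrict_iff' measurableSet_Ioc]
    filter_upwards [h.ae_norm_deriv_le] with τ hτ hτ'
    simp only [Function.uncurry, norm_mul]
    rw [integral_mul_const, norm_mul, norm_norm, Real.norm_of_nonneg (by positivity)]
    have h0 : 0 ≤ ∫ z, ‖dbar f z / (z - r τ)‖ := by positivity
    exact mul_le_mul (hC (r τ)).2 (hτ hτ') (norm_nonneg _) (h0.trans (hC (r τ)).2)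
  -- The inner integral over `z` is evaluated by Cauchy–Pompeiu (`hl`); the one over `τ` is a
  -- winding number (`hr`).
  have hswap := integral_integral_swap hint
  have hl : ∀ τ, ∫ z, dbar f z / (z - r τ) * deriv r τ =
      -(2 * π) * (f (r τ) * deriv r τ) := by
    intro τ
    rw [integral_mul_const, integral_dbar_div_sub hf hc, mul_assoc]
  have hr : ∀ z, ∫ τ in Ioc 0 (2 * π), dbar f z / (z - r τ) * deriv r τ =
      -(2 * π) * (Complex.I * (dbar f z * windingNumber r z)) := by
    intro z
    rw [windingNumber, intervalIntegral.integral_of_le Real.two_pi_pos.le]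
    have : ∀ τ, dbar f z / (z - r τ) * deriv r τ = -dbar f z * (deriv r τ / (r τ - z)) := by
      intro τ
      rw [← neg_sub (r τ) z, div_neg]
      ring
    simp only [this]
    rw [integral_const_mul]
    field_simp [Complex.I_ne_zero]
  simp only [hl, hr] at hswap
  rw [integral_const_mul, integral_const_mul, integral_const_mul] at hswap
  rw [intervalIntegral.integral_of_le Real.two_pi_pos.le]
  exact mul_left_cancel₀ (neg_ne_zero.2 hpi) hswap

end Pompeiu

/-! ### The divergence theorem on a parametrized plane domain -/

namespace IsPlaneParam

variable {ρ : ℂ → ℂ}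

/-- Almost everywhere the winding number is the indicator function of the domain. -/
theorem integral_mul_deriv (h : IsPlaneParam ρ) {f : ℂ → ℂ} (hf : ContDiff ℝ 1 f)
    (hc : HasCompactSupport f) :
    ∫ τ in (0 : ℝ)..(2 * π), f (boundaryCurve ρ τ) * deriv (boundaryCurve ρ) τ =
      Complex.I * ∫ z in ρ '' Metric.closedBall 0 1, dbar f z := by
  obtain ⟨S, M, hC⟩ := h.exists_isC1Curve
  rw [hC.integral_mul_deriv hf hc, ← integral_indicator h.isCompact_image.measurableSet]
  congr 1
  refine integral_congr_ae ?_
  filter_upwards [compl_mem_ae_iff.2 h.volume_image_sphere] with z hz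
  by_cases hz' : z ∈ ρ '' Metric.closedBall 0 1
  · rw [indicator_of_mem hz', h.positive z ⟨hz', hz⟩, mul_one]
  · rw [indicator_of_notMem hz', h.windingNumber_eq_zero hz', mul_zero]

/-- Since `f` is complex valued, the `dz` formula alone does not separate `dx` from `dy`. Applying
it to `conj f` and conjugating gives the `dz̄` formula; half the sum and half the difference are the
two claims. -/
theorem integral_mul_deriv_coord (h : IsPlaneParam ρ) {f : ℂ → ℂ} (hf : ContDiff ℝ 1 f)
    (hc : HasCompactSupport f) :
    (∫ τ in (0 : ℝ)..(2 * π), f (boundaryCurve ρ τ) * ((deriv (boundaryCurve ρ) τ).im : ℂ) =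
      ∫ z in ρ '' Metric.closedBall 0 1, fderiv ℝ f z 1) ∧
    (∫ τ in (0 : ℝ)..(2 * π), f (boundaryCurve ρ τ) * ((deriv (boundaryCurve ρ) τ).re : ℂ) =
      -∫ z in ρ '' Metric.closedBall 0 1, fderiv ℝ f z Complex.I) := by
  obtain ⟨S, M, hC⟩ := h.exists_isC1Curve
  have hcont : ContinuousOn (fun τ => f (boundaryCurve ρ τ)) (Icc 0 (2 * π)) :=
    (hf.continuous.comp hC.continuous).continuousOn
  have hi := hC.intervalIntegrable_mul_deriv hcont (Complex.ofRealCLM.comp Complex.imCLM)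
  have hr := hC.intervalIntegrable_mul_deriv hcont (Complex.ofRealCLM.comp Complex.reCLM)
  simp only [ContinuousLinearMap.comp_apply, Complex.imCLM_apply, Complex.reCLM_apply,
    Complex.ofRealCLM_apply] at hi hr
  have hfd := hf.continuous_fderiv one_ne_zero
  have hx : IntegrableOn (fun z => fderiv ℝ f z 1) (ρ '' Metric.closedBall 0 1) :=
    ContinuousOn.integrableOn_compact h.isCompact_image (Continuous.continuousOn (by fun_prop))
  have hy : IntegrableOn (fun z => fderiv ℝ f z Complex.I) (ρ '' Metric.closedBall 0 1) :=
    ContinuousOn.integrableOn_compact h.isCompact_image (Continuous.continuousOn (by fun_prop))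
  have h1 : (∫ τ in (0 : ℝ)..(2 * π),
        f (boundaryCurve ρ τ) * ((deriv (boundaryCurve ρ) τ).re : ℂ)) +
      Complex.I * (∫ τ in (0 : ℝ)..(2 * π),
        f (boundaryCurve ρ τ) * ((deriv (boundaryCurve ρ) τ).im : ℂ)) =
      Complex.I * ((∫ z in ρ '' Metric.closedBall 0 1, fderiv ℝ f z 1) +
        Complex.I * ∫ z in ρ '' Metric.closedBall 0 1, fderiv ℝ f z Complex.I) := by
    have := h.integral_mul_deriv hf hc
    simp only [dbar] at this
    rw [integral_add hx (hy.const_mul _), integral_const_mul] at this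
    rw [← this, ← intervalIntegral.integral_const_mul, ← intervalIntegral.integral_add hr
      (hi.const_mul _)]
    refine intervalIntegral.integral_congr fun τ _ => ?_
    linear_combination f (boundaryCurve ρ τ) * Complex.re_add_im (deriv (boundaryCurve ρ) τ)
  have h2 : (∫ τ in (0 : ℝ)..(2 * π),
        f (boundaryCurve ρ τ) * ((deriv (boundaryCurve ρ) τ).re : ℂ)) -
      Complex.I * (∫ τ in (0 : ℝ)..(2 * π),
        f (boundaryCurve ρ τ) * ((deriv (boundaryCurve ρ) τ).im : ℂ)) =
      -Complex.I * ((∫ z in ρ '' Metric.closedBall 0 1, fderiv ℝ f z 1) -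
        Complex.I * ∫ z in ρ '' Metric.closedBall 0 1, fderiv ℝ f z Complex.I) := by
    have := h.integral_mul_deriv (f := fun z => Complex.conjCLE (f z))
      (Complex.conjCLE.contDiff.comp hf) (hc.comp_left (map_zero _))
    have hd : ∀ z v, fderiv ℝ (fun z => Complex.conjCLE (f z)) z v =
        (starRingEnd ℂ) (fderiv ℝ f z v) := fun z v =>
      DFunLike.congr_fun (Complex.conjCLE.comp_fderiv (f := f) (x := z)) v
    simp only [dbar, hd] at this
    have := congrArg (starRingEnd ℂ) this
    rw [intervalIntegral.integral_of_le Real.two_pi_pos.le, map_mul, ← integral_conj,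
      ← integral_conj, ← intervalIntegral.integral_of_le Real.two_pi_pos.le] at this
    simp only [map_mul, map_add, Complex.conj_I, Complex.conj_conj,
      Complex.conjCLE_apply] at this
    rw [integral_add hx (hy.const_mul _), integral_const_mul] at this
    rw [sub_eq_add_neg _ (Complex.I * ∫ z in ρ '' Metric.closedBall 0 1, fderiv ℝ f z Complex.I),
      ← neg_mul, ← this, ← intervalIntegral.integral_const_mul,
      ← intervalIntegral.integral_sub hr (hi.const_mul _)]
    refine intervalIntegral.integral_congr fun τ _ => ?_
    have hconj : (starRingEnd ℂ) (deriv (boundaryCurve ρ) τ) =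
        (deriv (boundaryCurve ρ) τ).re - (deriv (boundaryCurve ρ) τ).im * Complex.I := by
      apply Complex.ext <;> simp
    rw [hconj]
    ring
  constructor
  · refine mul_left_cancel₀ Complex.I_ne_zero ?_
    linear_combination (h1 - h2) / 2
  · linear_combination (h1 + h2) / 2 +
      (∫ z in ρ '' Metric.closedBall 0 1, fderiv ℝ f z Complex.I) * Complex.I_mul_I

end IsPlaneParam

/-- The divergence of the field `V₁ ∂/∂x + V₂ ∂/∂y`. -/
noncomputable def planeDiv (V₁ V₂ : ℂ → ℂ) (z : ℂ) : ℂ :=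
  fderiv ℝ V₁ z 1 + fderiv ℝ V₂ z Complex.I

/-- The integrand of the flux of `V₁ ∂/∂x + V₂ ∂/∂y` through the curve `r`. -/
noncomputable def fluxPullback (V₁ V₂ : ℂ → ℂ) (r : ℝ → ℂ) (τ : ℝ) : ℂ :=
  V₁ (r τ) * ((deriv r τ).im : ℂ) - V₂ (r τ) * ((deriv r τ).re : ℂ)

theorem IsC1Curve.intervalIntegrable_fluxPullback {r : ℝ → ℂ} {S : Set ℝ} {M : ℝ}
    (h : IsC1Curve r S M) {V₁ V₂ : ℂ → ℂ} {J : Set ℂ} (hr : ∀ τ, r τ ∈ J)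
    (hV₁ : ContinuousOn V₁ J) (hV₂ : ContinuousOn V₂ J) :
    IntervalIntegrable (fluxPullback V₁ V₂ r) volume 0 (2 * π) := by
  have hi := h.intervalIntegrable_mul_deriv
    (hV₁.comp_continuous h.continuous hr).continuousOn (Complex.ofRealCLM.comp Complex.imCLM)
  have hr' := h.intervalIntegrable_mul_deriv
    (hV₂.comp_continuous h.continuous hr).continuousOn (Complex.ofRealCLM.comp Complex.reCLM)
  exact hi.sub hr'

/-- Multiplication by a cutoff equal to `1` near `K`. Agreement on neighbourhoods, not just on `K`,
carries over to the derivatives. -/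
theorem exists_contDiff_eqOn_nhds {U K : Set ℂ} (hU : IsOpen U) (hK : IsCompact K) (hKU : K ⊆ U)
    {f : ℂ → ℂ} (hf : ContDiffOn ℝ 1 f U) :
    ∃ g : ℂ → ℂ, ContDiff ℝ 1 g ∧ HasCompactSupport g ∧ ∀ z ∈ K, g =ᶠ[𝓝 z] f := by
  obtain ⟨K', hK', hKK', hK'U⟩ := exists_compact_between hK hU hKU
  obtain ⟨χ, hχ1, hχ0, -⟩ := exists_contMDiffMap_one_nhds_of_subset_interior
    (modelWithCornersSelf ℝ ℂ) (n := 1) hK.isClosed hKK'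
  have hχ : ContDiff ℝ 1 χ := χ.contMDiff.contDiff
  refine ⟨fun z => (χ z : ℂ) * f z, ?_, ?_, ?_⟩
  · rw [contDiff_iff_contDiffAt]
    intro z
    by_cases hz : z ∈ U
    · exact (Complex.ofRealCLM.contDiff.comp hχ).contDiffAt.mul (hf.contDiffAt (hU.mem_nhds hz))
    · refine (contDiffAt_const (c := (0 : ℂ))).congr_of_eventuallyEq ?_
      filter_upwards [hK'.isClosed.isOpen_compl.mem_nhds fun h => hz (hK'U h)] with w hw
      rw [hχ0 w hw, Complex.ofReal_zero, zero_mul]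
  · refine HasCompactSupport.intro hK' fun z hz => ?_
    rw [hχ0 z hz, Complex.ofReal_zero, zero_mul]
  · intro z hz
    filter_upwards [eventually_nhdsSet_iff_forall.1 hχ1 z hz] with w hw
    rw [hw, Complex.ofReal_one, one_mul]

namespace IsPlaneParam

variable {ρ : ℂ → ℂ}

theorem boundaryCurve_mem (ρ : ℂ → ℂ) (τ : ℝ) :
    boundaryCurve ρ τ ∈ ρ '' Metric.closedBall 0 1 :=
  ⟨_, Metric.sphere_subset_closedBall (exp_mem_sphere τ), rfl⟩

/-- The divergence theorem for a field that is `C¹` near the domain. -/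
theorem integral_fluxPullback_of_contDiffOn (h : IsPlaneParam ρ) {U : Set ℂ} (hU : IsOpen U)
    (hρU : ρ '' Metric.closedBall 0 1 ⊆ U) {V₁ V₂ : ℂ → ℂ} (hV₁ : ContDiffOn ℝ 1 V₁ U)
    (hV₂ : ContDiffOn ℝ 1 V₂ U) :
    ∫ τ in (0 : ℝ)..(2 * π), fluxPullback V₁ V₂ (boundaryCurve ρ) τ =
      ∫ z in ρ '' Metric.closedBall 0 1, planeDiv V₁ V₂ z := by
  obtain ⟨S, M, hC⟩ := h.exists_isC1Curve
  obtain ⟨g₁, hg₁, hc₁, he₁⟩ := exists_contDiff_eqOn_nhds hU h.isCompact_image hρU hV₁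
  obtain ⟨g₂, hg₂, hc₂, he₂⟩ := exists_contDiff_eqOn_nhds hU h.isCompact_image hρU hV₂
  have hl : ∀ τ, fluxPullback V₁ V₂ (boundaryCurve ρ) τ =
      g₁ (boundaryCurve ρ τ) * ((deriv (boundaryCurve ρ) τ).im : ℂ) -
      g₂ (boundaryCurve ρ τ) * ((deriv (boundaryCurve ρ) τ).re : ℂ) := fun τ => by
    rw [fluxPullback, (he₁ _ (boundaryCurve_mem ρ τ)).eq_of_nhds,
      (he₂ _ (boundaryCurve_mem ρ τ)).eq_of_nhds]
  have hr : ∀ z ∈ ρ '' Metric.closedBall 0 1, planeDiv V₁ V₂ z =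
      fderiv ℝ g₁ z 1 + fderiv ℝ g₂ z Complex.I := fun z hz => by
    rw [planeDiv, (he₁ z hz).fderiv_eq, (he₂ z hz).fderiv_eq]
  have hfd₁ := hg₁.continuous_fderiv one_ne_zero
  have hfd₂ := hg₂.continuous_fderiv one_ne_zero
  simp only [hl]
  rw [setIntegral_congr_fun h.isCompact_image.measurableSet hr, integral_add
      (ContinuousOn.integrableOn_compact h.isCompact_image (Continuous.continuousOn (by fun_prop)))
      (ContinuousOn.integrableOn_compact h.isCompact_image (Continuous.continuousOn (by fun_prop))),
    ← (h.integral_mul_deriv_coord hg₁ hc₁).1,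
    ← neg_neg (∫ z in ρ '' Metric.closedBall 0 1, fderiv ℝ g₂ z Complex.I),
    ← (h.integral_mul_deriv_coord hg₂ hc₂).2, ← sub_eq_add_neg]
  exact intervalIntegral.integral_sub
    (hC.intervalIntegrable_mul_deriv (hg₁.continuous.comp hC.continuous).continuousOn
      (Complex.ofRealCLM.comp Complex.imCLM))
    (hC.intervalIntegrable_mul_deriv (hg₂.continuous.comp hC.continuous).continuousOn
      (Complex.ofRealCLM.comp Complex.reCLM))

/-! ### Exhaustion of a domain by homothety -/

theorem deriv_homothety (c : ℂ) (k : ℝ) (r : ℝ → ℂ) (τ : ℝ) :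
    deriv (fun t => c + (k : ℂ) * (r t - c)) τ = k * deriv r τ := by
  simp

/-- A parametrized domain shrunk towards a point. -/
theorem homothety (h : IsPlaneParam ρ) (c : ℂ) {k : ℝ} (hk : k ≠ 0) :
    IsPlaneParam fun q => c + (k : ℂ) * (ρ q - c) := by
  have hk' : (k : ℂ) ≠ 0 := by exact_mod_cast hk
  have hinj : Function.Injective fun z : ℂ => c + (k : ℂ) * (z - c) := fun z w e => by
    have := mul_left_cancel₀ hk' (add_left_cancel e)
    exact sub_left_injective this
  have himage : ∀ s : Set ℂ, (fun q => c + (k : ℂ) * (ρ q - c)) '' s =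
      (fun z : ℂ => c + (k : ℂ) * (z - c)) '' (ρ '' s) := fun s => by rw [image_image]
  refine ⟨?_, ?_, ?_, ?_⟩
  · exact continuousOn_const.add (continuousOn_const.mul (h.continuousOn.sub continuousOn_const))
  · exact fun x hx y hy e => h.injOn hx hy (hinj e)
  · obtain ⟨n, t, ht, h0, hn, hr⟩ := h.piecewise
    refine ⟨n, t, ht, h0, hn, fun j hj => ?_⟩
    exact contDiffOn_const.add (contDiffOn_const.mul ((hr j hj).sub contDiffOn_const))
  · intro z hz
    rw [himage, himage, ← image_sdiff hinj] at hz
    obtain ⟨w, hw, rfl⟩ := hz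
    rw [← h.positive w hw, windingNumber, windingNumber]
    congr 1
    refine intervalIntegral.integral_congr fun τ _ => ?_
    have : boundaryCurve (fun q => c + (k : ℂ) * (ρ q - c)) =
        fun t => c + (k : ℂ) * (boundaryCurve ρ t - c) := rfl
    simp only [this, deriv_homothety]
    rw [show c + (k : ℂ) * (boundaryCurve ρ τ - c) - (c + k * (w - c)) =
      k * (boundaryCurve ρ τ - w) by ring, mul_div_mul_left _ _ hk']

/-- The divergence theorem for a field that is continuous on a compact convex set and `C¹` in its
interior, with integrable divergence. The domain may touch the boundary of the convex set. -/
theorem integral_fluxPullback_of_continuousOn (h : IsPlaneParam ρ) {J : Set ℂ} (hJ : IsCompact J)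
    (hJc : Convex ℝ J) {c : ℂ} (hcJ : c ∈ interior J) (hρJ : ρ '' Metric.closedBall 0 1 ⊆ J)
    {V₁ V₂ : ℂ → ℂ} (hV₁c : ContinuousOn V₁ J) (hV₂c : ContinuousOn V₂ J)
    (hV₁ : ContDiffOn ℝ 1 V₁ (interior J)) (hV₂ : ContDiffOn ℝ 1 V₂ (interior J))
    (hint : IntegrableOn (planeDiv V₁ V₂) J) :
    ∫ τ in (0 : ℝ)..(2 * π), fluxPullback V₁ V₂ (boundaryCurve ρ) τ =
      ∫ z in ρ '' Metric.closedBall 0 1, planeDiv V₁ V₂ z := by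
  obtain ⟨S, M, hC⟩ := h.exists_isC1Curve
  set K := ρ '' Metric.closedBall 0 1
  set r := boundaryCurve ρ
  have hrJ : ∀ τ, r τ ∈ J := fun τ => hρJ (boundaryCurve_mem ρ τ)
  obtain ⟨k, hk0, hk1, hklim⟩ : ∃ k : ℕ → ℝ, (∀ n, 0 < k n) ∧ (∀ n, k n < 1) ∧
      Tendsto k atTop (𝓝 1) := by
    -- The shifted index makes `k 0 = 1/2`, so that no ratio is zero.
    refine ⟨fun n => 1 - 1 / ((n + 1 : ℕ) + 1 : ℝ), fun n => ?_, fun n => ?_, ?_⟩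
    · have h2 : (1 : ℝ) < (n + 1 : ℕ) + 1 := by push_cast; linarith [Nat.cast_nonneg (α := ℝ) n]
      have : 1 / (((n + 1 : ℕ) : ℝ) + 1) < 1 := by rw [div_lt_one (by linarith)]; exact h2
      linarith
    · have : (0 : ℝ) < 1 / (((n + 1 : ℕ) : ℝ) + 1) := by positivity
      linarith
    · have := (tendsto_one_div_add_atTop_nhds_zero_nat (𝕜 := ℝ)).comp (tendsto_add_atTop_nat 1)
      simpa using (tendsto_const_nhds (x := (1 : ℝ))).sub this
  have hklim' : Tendsto (fun n => (k n : ℂ)) atTop (𝓝 1) := by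
    simpa [Function.comp_def] using (Complex.continuous_ofReal.tendsto 1).comp hklim
  let T : ℕ → ℂ → ℂ := fun n z => c + (k n : ℂ) * (z - c)
  -- Convexity: moving a point of `J` towards an interior point lands in the interior.
  have hT : ∀ n, ∀ z ∈ J, T n z ∈ interior J := by
    intro n z hz
    have := hJc.add_smul_sub_mem_interior hz hcJ (t := 1 - k n)
      ⟨by linarith [hk1 n], by linarith [hk0 n]⟩
    have e : T n z = z + (1 - k n) • (c - z) := by
      simp only [T, Complex.real_smul]
      push_cast
      ring
    rwa [e]
  have hTlim : ∀ z, Tendsto (fun n => T n z) atTop (𝓝 z) := by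
    intro z
    have := (hklim'.mul_const (z - c)).const_add c
    simpa using this
  have hstep : ∀ n, ∫ τ in (0 : ℝ)..(2 * π),
      (V₁ (T n (r τ)) * ((k n * (deriv r τ).im : ℝ) : ℂ) -
        V₂ (T n (r τ)) * ((k n * (deriv r τ).re : ℝ) : ℂ)) =
      ∫ z, (T n '' K).indicator (planeDiv V₁ V₂) z := by
    intro n
    have hp := h.homothety c (hk0 n).ne'
    have himage : (fun q => c + (k n : ℂ) * (ρ q - c)) '' Metric.closedBall 0 1 = T n '' K := by
      rw [image_image]
    have hsub : T n '' K ⊆ interior J := by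
      rintro _ ⟨z, hz, rfl⟩
      exact hT n z (hρJ hz)
    have := hp.integral_fluxPullback_of_contDiffOn isOpen_interior (himage ▸ hsub) hV₁ hV₂
    rw [himage] at this
    rw [integral_indicator (himage ▸ hp.isCompact_image.measurableSet), ← this]
    refine intervalIntegral.integral_congr fun τ _ => ?_
    have hb : boundaryCurve (fun q => c + (k n : ℂ) * (ρ q - c)) =
        fun t => c + (k n : ℂ) * (r t - c) := rfl
    simp only [hb, fluxPullback, deriv_homothety, T, Complex.re_ofReal_mul, Complex.im_ofReal_mul]
  -- The shrunken domains all lie in `J`, so the integrable divergence on `J` dominates.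
  have hR : Tendsto (fun n => ∫ z, (T n '' K).indicator (planeDiv V₁ V₂) z) atTop
      (𝓝 (∫ z, K.indicator (planeDiv V₁ V₂) z)) := by
    have hmeasK : ∀ n, MeasurableSet (T n '' K) := fun n => by
      refine (h.isCompact_image.image ?_).measurableSet
      fun_prop
    have hsubJ : ∀ n, T n '' K ⊆ J := fun n => by
      rintro _ ⟨z, hz, rfl⟩
      exact interior_subset (hT n z (hρJ hz))
    have hindJ : Integrable (J.indicator (planeDiv V₁ V₂)) :=
      hint.integrable_indicator hJ.measurableSet
    refine tendsto_integral_of_dominated_convergence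
      (fun z => ‖J.indicator (planeDiv V₁ V₂) z‖) ?_ hindJ.norm ?_ ?_
    · exact fun n => ((hint.mono_set (hsubJ n)).integrable_indicator (hmeasK n)).aestronglyMeasurable
    · exact fun n => Eventually.of_forall fun z =>
        norm_indicator_le_of_subset (hsubJ n) (planeDiv V₁ V₂) z
    · filter_upwards [compl_mem_ae_iff.2 h.volume_image_sphere] with z hz
      -- Membership is tested by the inverse homothety, whose value at `z` tends to `z`. The inside
      -- and the outside of `K` are open, so off the null boundary the indicators are eventually
      -- constant.
      have hmem : ∀ n, z ∈ T n '' K ↔ c + ((k n)⁻¹ : ℂ) * (z - c) ∈ K := by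
        intro n
        have hkn : (k n : ℂ) ≠ 0 := by exact_mod_cast (hk0 n).ne'
        constructor
        · rintro ⟨w, hw, rfl⟩
          simpa [T, hkn] using hw
        · intro hw
          refine ⟨_, hw, ?_⟩
          simp [T, hkn]
      have hinv : Tendsto (fun n => c + ((k n)⁻¹ : ℂ) * (z - c)) atTop (𝓝 z) := by
        have := ((hklim'.inv₀ one_ne_zero).mul_const (z - c)).const_add c
        simpa using this
      refine tendsto_const_nhds.congr' ?_
      by_cases hzK : z ∈ K
      · filter_upwards [hinv.eventually_mem (h.isOpen_image_diff.mem_nhds ⟨hzK, hz⟩)] with n hn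
        rw [indicator_of_mem hzK, indicator_of_mem ((hmem n).2 hn.1)]
      · filter_upwards [hinv.eventually_mem
          (h.isCompact_image.isClosed.isOpen_compl.mem_nhds hzK)] with n hn
        rw [indicator_of_notMem hzK, indicator_of_notMem fun hh => hn ((hmem n).1 hh)]
  have hL : Tendsto (fun n => ∫ τ in (0 : ℝ)..(2 * π),
      (V₁ (T n (r τ)) * ((k n * (deriv r τ).im : ℝ) : ℂ) -
        V₂ (T n (r τ)) * ((k n * (deriv r τ).re : ℝ) : ℂ))) atTop
      (𝓝 (∫ τ in (0 : ℝ)..(2 * π), fluxPullback V₁ V₂ r τ)) := by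
    obtain ⟨C₁, hC₁⟩ := hJ.exists_bound_of_continuousOn hV₁c
    obtain ⟨C₂, hC₂⟩ := hJ.exists_bound_of_continuousOn hV₂c
    refine intervalIntegral.tendsto_integral_filter_of_dominated_convergence
      (fun _ => C₁ * M + C₂ * M) ?_ ?_ (by simp) ?_
    · refine Eventually.of_forall fun n => AEStronglyMeasurable.sub ?_ ?_
      · refine AEStronglyMeasurable.mul (Continuous.aestronglyMeasurable ?_)
          (Measurable.aestronglyMeasurable ?_)
        · refine hV₁c.comp_continuous (f := fun τ => T n (r τ)) ?_
            fun τ => interior_subset (hT n _ (hrJ τ))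
          exact continuous_const.add (continuous_const.mul (hC.continuous.sub continuous_const))
        · have := measurable_deriv r
          fun_prop
      · refine AEStronglyMeasurable.mul (Continuous.aestronglyMeasurable ?_)
          (Measurable.aestronglyMeasurable ?_)
        · refine hV₂c.comp_continuous (f := fun τ => T n (r τ)) ?_
            fun τ => interior_subset (hT n _ (hrJ τ))
          exact continuous_const.add (continuous_const.mul (hC.continuous.sub continuous_const))
        · have := measurable_deriv r
          fun_prop
    · refine Eventually.of_forall fun n => ?_
      rw [uIoc_of_le Real.two_pi_pos.le]
      filter_upwards [hC.ae_norm_deriv_le] with τ hτ hτ'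
      have hTJ := interior_subset (hT n _ (hrJ τ))
      have hM := hτ hτ'
      have key : ∀ (x : ℝ), |x| ≤ ‖deriv r τ‖ → ‖((k n * x : ℝ) : ℂ)‖ ≤ M := by
        intro x hx
        rw [Complex.norm_real, norm_mul, Real.norm_of_nonneg (hk0 n).le]
        exact (mul_le_of_le_one_left (norm_nonneg _) (hk1 n).le).trans (hx.trans hM)
      refine (norm_sub_le _ _).trans (add_le_add ?_ ?_)
      · rw [norm_mul]
        exact mul_le_mul (hC₁ _ hTJ) (key _ (Complex.abs_im_le_norm _)) (norm_nonneg _)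
          ((norm_nonneg _).trans (hC₁ _ hTJ))
      · rw [norm_mul]
        exact mul_le_mul (hC₂ _ hTJ) (key _ (Complex.abs_re_le_norm _)) (norm_nonneg _)
          ((norm_nonneg _).trans (hC₂ _ hTJ))
    · refine Eventually.of_forall fun τ _ => ?_
      have hwithin : Tendsto (fun n => T n (r τ)) atTop (𝓝[J] (r τ)) :=
        tendsto_nhdsWithin_iff.2 ⟨hTlim _,
          Eventually.of_forall fun n => interior_subset (hT n _ (hrJ τ))⟩
      have hre : ∀ x : ℝ, Tendsto (fun n => ((k n * x : ℝ) : ℂ)) atTop (𝓝 (x : ℂ)) := by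
        intro x
        have := hklim'.mul_const (x : ℂ)
        simpa using this
      exact (((hV₁c _ (hrJ τ)).tendsto.comp hwithin).mul (hre _)).sub
        (((hV₂c _ (hrJ τ)).tendsto.comp hwithin).mul (hre _))
  simp only [hstep] at hL
  rw [← integral_indicator h.isCompact_image.measurableSet]
  exact tendsto_nhds_unique hL hR

end IsPlaneParam

/-! ### Fractional integrals of absolutely continuous functions -/

/-- Convolution with an integrable kernel preserves bounded variation. -/
theorem boundedVariationOn_convolution {k g : ℝ → ℂ} {s : Set ℝ} (hk : IntegrableOn k s)
    (hg : BoundedVariationOn g univ) (hgm : Measurable g) :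
    BoundedVariationOn (fun y => ∫ x in s, k x * g (y - x)) univ := by
  obtain ⟨B, hB⟩ : ∃ B, ∀ y, ‖g y‖ ≤ B := by
    refine ⟨‖g 0‖ + (eVariationOn g univ).toReal, fun y => ?_⟩
    have := hg.dist_le (mem_univ y) (mem_univ 0)
    rw [dist_eq_norm] at this
    linarith [norm_le_norm_add_norm_sub' (g y) (g 0)]
  have hmeas : ∀ y, Measurable fun x => g (y - x) := fun y =>
    hgm.comp (measurable_const.sub measurable_id)
  have hint : ∀ y, Integrable (fun x => k x * g (y - x)) (volume.restrict s) := fun y =>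
    Integrable.mul_bdd (c := B) hk (hmeas y).aestronglyMeasurable
      (Eventually.of_forall fun x => hB _)
  have hkfin : ∫⁻ x in s, ‖k x‖ₑ ≠ ⊤ := hk.2.ne
  refine ne_top_of_le_ne_top (ENNReal.mul_ne_top hkfin hg) (iSup_le ?_)
  rintro ⟨n, u, hu, -⟩
  calc ∑ i ∈ Finset.range n, edist (∫ x in s, k x * g (u (i + 1) - x))
        (∫ x in s, k x * g (u i - x))
      ≤ ∑ i ∈ Finset.range n, ∫⁻ x in s,
          ‖k x‖ₑ * edist (g (u (i + 1) - x)) (g (u i - x)) := by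
        refine Finset.sum_le_sum fun i _ => ?_
        rw [edist_eq_enorm_sub, ← integral_sub (hint _) (hint _)]
        refine (enorm_integral_le_lintegral_enorm _).trans_eq (lintegral_congr fun x => ?_)
        rw [← mul_sub, enorm_mul, edist_eq_enorm_sub]
    _ = ∫⁻ x in s, ∑ i ∈ Finset.range n,
          ‖k x‖ₑ * edist (g (u (i + 1) - x)) (g (u i - x)) := by
        rw [lintegral_finsetSum']
        intro i _
        exact hk.1.enorm.mul ((hmeas _).edist (hmeas _)).aemeasurable
    _ ≤ ∫⁻ x in s, ‖k x‖ₑ * eVariationOn g univ := by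
        refine lintegral_mono fun x => ?_
        rw [← Finset.mul_sum]
        gcongr
        -- The partition translated by `x` is again monotone, so its sum is at most the total
        -- variation, uniformly in `x`.
        exact eVariationOn.sum_le (u := fun i => u i - x)
          (fun i j hij => sub_le_sub_right (hu hij) x) fun _ => mem_univ _
    _ = (∫⁻ x in s, ‖k x‖ₑ) * eVariationOn g univ := lintegral_mul_const'' _ hk.1.enorm

theorem intervalIntegrable_deriv_of_boundedVariationOn {u : ℝ → ℂ} {a b : ℝ}
    (hu : BoundedVariationOn u (uIcc a b)) : IntervalIntegrable (deriv u) volume a b := by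
  have hre : BoundedVariationOn (fun x => (u x).re) (uIcc a b) :=
    Complex.reCLM.lipschitz.comp_boundedVariationOn hu
  have him : BoundedVariationOn (fun x => (u x).im) (uIcc a b) :=
    Complex.imCLM.lipschitz.comp_boundedVariationOn hu
  have h1 : IntervalIntegrable (fun x => ((deriv (fun x => (u x).re) x : ℝ) : ℂ) +
      ((deriv (fun x => (u x).im) x : ℝ) : ℂ) * Complex.I) volume a b :=
    have hr := hre.intervalIntegrable_deriv
    have hi := him.intervalIntegrable_deriv
    IntervalIntegrable.add ⟨hr.1.ofReal, hr.2.ofReal⟩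
      (IntervalIntegrable.mul_const ⟨hi.1.ofReal, hi.2.ofReal⟩ _)
  refine h1.congr_ae ?_
  rw [EventuallyEq, ae_restrict_iff' measurableSet_uIoc]
  filter_upwards [hu.ae_differentiableAt_of_mem_uIcc] with x hx hx'
  have hd := (hx (uIoc_subset_uIcc hx')).hasDerivAt
  have hdre := Complex.reCLM.hasFDerivAt.comp_hasDerivAt x hd
  have hdim := Complex.imCLM.hasFDerivAt.comp_hasDerivAt x hd
  have e1 : deriv (fun x => (u x).re) x = (deriv u x).re := hdre.deriv
  have e2 : deriv (fun x => (u x).im) x = (deriv u x).im := hdim.deriv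
  rw [e1, e2, Complex.re_add_im]

/-- A monotone left inverse of a strictly monotone function on `[a, b]`. -/
theorem exists_monotone_leftInverse {a b : ℝ} (hab : a ≤ b) {ψ : ℝ → ℝ}
    (hψ : StrictMonoOn ψ (Icc a b)) :
    ∃ q : ℝ → ℝ, Monotone q ∧ (∀ y, q y ∈ Icc a b) ∧ ∀ t ∈ Icc a b, q (ψ t) = t := by
  -- The alternative `t = a` keeps the set nonempty when `y < ψ a`, which makes the inverse total
  -- and monotone.
  have hne : ∀ y, a ∈ {t ∈ Icc a b | t = a ∨ ψ t ≤ y} := fun y => ⟨⟨le_rfl, hab⟩, Or.inl rfl⟩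
  have hbdd : ∀ y, BddAbove {t ∈ Icc a b | t = a ∨ ψ t ≤ y} := fun y => ⟨b, fun t ht => ht.1.2⟩
  refine ⟨fun y => sSup {t ∈ Icc a b | t = a ∨ ψ t ≤ y}, ?_, ?_, ?_⟩
  · intro y y' hy
    refine csSup_le_csSup (hbdd y') ⟨a, hne y⟩ fun t ht => ⟨ht.1, ht.2.imp_right fun h => h.trans hy⟩
  · exact fun y => ⟨le_csSup (hbdd y) (hne y), csSup_le ⟨a, hne y⟩ fun t ht => ht.1.2⟩
  · intro t ht
    refine IsGreatest.csSup_eq ⟨⟨ht, Or.inr le_rfl⟩, fun t' ht' => ?_⟩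
    rcases ht'.2 with rfl | h
    · exact ht.1
    · exact (hψ.le_iff_le ht'.1 ht).1 h

/-- Positivity of `β` gives integrability of the power at `0`; the exponential is bounded on `[0,
L]`. -/
theorem integrableOn_propFrac_kernel {β c L : ℝ} (hβ : 0 < β) :
    IntegrableOn (fun x : ℝ => ((Real.exp (c * x) * x ^ (β - 1) : ℝ) : ℂ)) (Ioo 0 L) := by
  rcases le_or_gt L 0 with hL | hL
  · simp [Ioo_eq_empty_of_le hL]
  have h1 : IntegrableOn (fun x : ℝ => x ^ (β - 1)) (Ioo 0 L) :=
    (intervalIntegral.integrableOn_Ioo_rpow_iff hL).2 (by linarith)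
  obtain ⟨C, hC⟩ := (isCompact_Icc (a := (0 : ℝ)) (b := L)).exists_bound_of_continuousOn
    (f := fun x : ℝ => Real.exp (c * x)) (Continuous.continuousOn (by fun_prop))
  refine Integrable.ofReal (Integrable.bdd_mul (c := C) h1 ?_ ?_)
  · exact Continuous.aestronglyMeasurable (by fun_prop)
  · rw [ae_restrict_iff' measurableSet_Ioo]
    exact Eventually.of_forall fun x hx => hC x (Ioo_subset_Icc_self hx)

/-- The proportional fractional integral of an absolutely continuous function has bounded
variation. -/
theorem boundedVariationOn_propFracIntegral {a b β s : ℝ} (hab : a < b) (hβ : 0 < β)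
    {ψ : ℝ → ℝ} (hψc : ContinuousOn ψ (Icc a b)) (hψd : ∀ t ∈ Ioo a b, 0 < deriv ψ t)
    {f : ℝ → ℂ} (hf : AbsolutelyContinuousOnInterval f a b) :
    BoundedVariationOn (propFracIntegral a β s ψ f) (Icc a b) := by
  have hmono : StrictMonoOn ψ (Icc a b) := strictMonoOn_of_deriv_pos (convex_Icc a b) hψc
    (by rwa [interior_Icc])
  obtain ⟨q, hq, hqmem, hqψ⟩ := exists_monotone_leftInverse hab.le hmono
  have hfc := hf.continuousOn
  have hfbv := hf.boundedVariationOn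
  rw [uIcc_of_le hab.le] at hfc hfbv
  set k : ℝ → ℂ := fun x => ((Real.exp ((s - 1) / s * x) * x ^ (β - 1) : ℝ) : ℂ) with hk
  have hki : IntegrableOn k (Ioo 0 (ψ b - ψ a)) := integrableOn_propFrac_kernel hβ
  -- With `y = ψ x - ψ t` the range of integration is `(0, ψ x - ψ a)`. The indicator truncates `g
  -- (ψ x - y)` exactly there, so the range can be fixed as `(0, ψ b - ψ a)` and the integral
  -- becomes a convolution evaluated at `ψ x`.
  set ind : ℝ → ℝ := (Ioi (ψ a)).indicator 1 with hind
  set g : ℝ → ℂ := ind • fun y => f (q y) with hg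
  have hfq : Measurable fun y => f (q y) := by
    have h1 : Continuous (IccExtend hab.le ((Icc a b).domRestrict f)) :=
      (continuousOn_iff_continuous_domRestrict.1 hfc).Icc_extend'
    have h2 := h1.measurable.comp hq.measurable
    exact (funext fun y => IccExtend_of_mem hab.le _ (hqmem y) :
      IccExtend hab.le ((Icc a b).domRestrict f) ∘ q = fun y => f (q y)) ▸ h2
  have hgm : Measurable g := (measurable_one.indicator measurableSet_Ioi).smul hfq
  have hgbv : BoundedVariationOn g univ := by
    refine BoundedVariationOn.smul ?_ ?_
    · refine MonotoneOn.boundedVariationOn (C := 1) ?_ ?_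
      · intro x _ y _ hxy
        by_cases hx : x ∈ Ioi (ψ a)
        · have hy : y ∈ Ioi (ψ a) := lt_of_lt_of_le hx hxy
          rw [hind, indicator_of_mem hx, indicator_of_mem hy]
          exact le_rfl
        · rw [hind, indicator_of_notMem hx]
          exact indicator_nonneg (fun _ _ => zero_le_one) y
      · intro x _
        rw [hind, indicator_apply]
        split_ifs <;> simp
    -- Precomposition with a monotone map does not increase the variation.
    · exact ne_top_of_le_ne_top hfbv
        (eVariationOn.comp_le_of_monotoneOn f q (hq.monotoneOn _) fun y _ => hqmem y)
  have hU := boundedVariationOn_convolution hki hgbv hgm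
  have hUψ : BoundedVariationOn
      (fun x => ∫ y in Ioo 0 (ψ b - ψ a), k y * g (ψ x - y)) (Icc a b) :=
    ne_top_of_le_ne_top hU
      (eVariationOn.comp_le_of_monotoneOn _ ψ hmono.monotoneOn (mapsTo_univ _ _))
  have heq : ∀ x ∈ Icc a b, propFracIntegral a β s ψ f x =
      ((1 / (s ^ β * Real.Gamma β) : ℝ) : ℂ) *
        ∫ y in Ioo 0 (ψ b - ψ a), k y * g (ψ x - y) := by
    intro x hx
    rw [propFracIntegral]
    congr 1
    have hsub : Icc a x ⊆ Icc a b := Icc_subset_Icc_right hx.2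
    have hd : ∀ t ∈ Ioo a x, HasDerivAt ψ (deriv ψ t) t := fun t ht =>
      (differentiableAt_of_deriv_ne_zero (hψd t ⟨ht.1, ht.2.trans_le hx.2⟩).ne').hasDerivAt
    have himage : (fun t => ψ x - ψ t) '' Ioo a x = Ioo 0 (ψ x - ψ a) := by
      ext y
      constructor
      · rintro ⟨t, ht, rfl⟩
        have h1 := hmono (hsub ⟨le_rfl, hx.1⟩) (hsub ⟨ht.1.le, ht.2.le⟩) ht.1
        have h2 := hmono (hsub ⟨ht.1.le, ht.2.le⟩) hx ht.2
        exact ⟨by simp only; linarith, by simp only; linarith⟩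
      · intro hy
        obtain ⟨t, ht, hty⟩ := intermediate_value_Ioo hx.1 (hψc.mono hsub)
          (show ψ x - y ∈ Ioo (ψ a) (ψ x) from ⟨by linarith [hy.2], by linarith [hy.1]⟩)
        exact ⟨t, ht, by simp only [hty]; ring⟩
    have hinj : InjOn (fun t => ψ x - ψ t) (Ioo a x) := fun t ht t' ht' e =>
      hmono.injOn (hsub (Ioo_subset_Icc_self ht)) (hsub (Ioo_subset_Icc_self ht'))
        (sub_right_injective e)
    have hcv := integral_image_eq_integral_abs_deriv_smul (s := Ioo a x)
      (f := fun t => ψ x - ψ t) (f' := fun t => -deriv ψ t) measurableSet_Ioo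
      (fun t ht => ((hd t ht).const_sub (ψ x)).hasDerivWithinAt) hinj
      (fun y => k y * g (ψ x - y))
    rw [himage] at hcv
    have hle : ψ x - ψ a ≤ ψ b - ψ a :=
      sub_le_sub_right (hmono.monotoneOn hx ⟨hab.le, le_rfl⟩ hx.2) _
    rw [setIntegral_eq_of_subset_of_forall_sdiff_eq_zero measurableSet_Ioo
      (Ioo_subset_Ioo_right hle), hcv, intervalIntegral.integral_of_le hx.1,
      integral_Ioc_eq_integral_Ioo]
    · refine setIntegral_congr_fun measurableSet_Ioo fun t ht => ?_
      have hta : ψ a < ψ t := hmono (hsub ⟨le_rfl, hx.1⟩) (hsub ⟨ht.1.le, ht.2.le⟩) ht.1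
      have hgt : g (ψ t) = f t := by
        rw [hg, Pi.smul_apply', hind, indicator_of_mem (show ψ t ∈ Ioi (ψ a) from hta),
          hqψ t (hsub ⟨ht.1.le, ht.2.le⟩)]
        simp
      have hdt := hψd t ⟨ht.1, ht.2.trans_le hx.2⟩
      simp only [abs_neg, abs_of_pos hdt, sub_sub_cancel, hgt, hk, Complex.real_smul]
      ring
    · intro y hy
      have hy' : ψ x - y ∉ Ioi (ψ a) := fun h => hy.2 ⟨hy.1.1, by
        have : ψ a < ψ x - y := h
        linarith⟩
      rw [hg, Pi.smul_apply', hind, indicator_of_notMem hy', zero_smul, mul_zero]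
  have hconst := (lipschitzWith_smul
    ((1 / (s ^ β * Real.Gamma β) : ℝ) : ℂ)).comp_boundedVariationOn hUψ
  rw [BoundedVariationOn, eVariationOn.congr (g := (fun z : ℂ =>
    ((1 / (s ^ β * Real.Gamma β) : ℝ) : ℂ) • z) ∘
      fun x => ∫ y in Ioo 0 (ψ b - ψ a), k y * g (ψ x - y)) heq]
  exact hconst

/-! ### Rectangles and partial derivatives -/

theorem rect_eq_reProdIm (p q : ℂ) : rect p q = Icc p.re q.re ×ℂ Icc p.im q.im := rfl

theorem isCompact_rect (p q : ℂ) : IsCompact (rect p q) := isCompact_Icc.reProdIm isCompact_Icc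

theorem convex_rect (p q : ℂ) : Convex ℝ (rect p q) :=
  ((convex_Icc p.re q.re).linear_preimage Complex.reLm).inter
    ((convex_Icc p.im q.im).linear_preimage Complex.imLm)

theorem interior_rect (p q : ℂ) : interior (rect p q) = Ioo p.re q.re ×ℂ Ioo p.im q.im := by
  rw [rect_eq_reProdIm, Complex.interior_reProdIm, interior_Icc, interior_Icc]

theorem nonempty_interior_rect {p q : ℂ} (hre : p.re < q.re) (him : p.im < q.im) :
    (interior (rect p q)).Nonempty := by
  rw [interior_rect]
  exact ⟨⟨(p.re + q.re) / 2, (p.im + q.im) / 2⟩, ⟨by simp only [mem_preimage]; constructor <;> linarith,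
    by simp only [mem_preimage]; constructor <;> linarith⟩⟩

theorem integrableOn_rect_comp_re {p q : ℂ} {g : ℝ → ℂ} (hg : IntegrableOn g (Icc p.re q.re)) :
    IntegrableOn (fun z : ℂ => g z.re) (rect p q) := by
  have h := hg.integrable.comp_fst (volume.restrict (Icc p.im q.im))
  rw [Measure.prod_restrict] at h
  exact (Complex.volume_preserving_equiv_real_prod.integrableOn_comp_preimage
    Complex.measurableEquivRealProd.measurableEmbedding).2 h

theorem integrableOn_rect_comp_im {p q : ℂ} {g : ℝ → ℂ} (hg : IntegrableOn g (Icc p.im q.im)) :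
    IntegrableOn (fun z : ℂ => g z.im) (rect p q) := by
  have h := hg.integrable.comp_snd (volume.restrict (Icc p.re q.re))
  rw [Measure.prod_restrict] at h
  exact (Complex.volume_preserving_equiv_real_prod.integrableOn_comp_preimage
    Complex.measurableEquivRealProd.measurableEmbedding).2 h

section Partial

variable {E : Type*} [NormedAddCommGroup E] [NormedSpace ℝ E] {s : Set ℂ} {g : ℂ → E} {z : ℂ}

theorem partialX_of_mem_nhds (hs : s ∈ 𝓝 z) (hg : DifferentiableAt ℝ g z) :
    partialX s g z = fderiv ℝ g z 1 := by
  rw [partialX, lineDerivWithin_of_mem_nhds hs, hg.lineDeriv_eq_fderiv]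

theorem partialY_of_mem_nhds (hs : s ∈ 𝓝 z) (hg : DifferentiableAt ℝ g z) :
    partialY s g z = fderiv ℝ g z Complex.I := by
  rw [partialY, lineDerivWithin_of_mem_nhds hs, hg.lineDeriv_eq_fderiv]

/-- Only the moving coordinate has to be interior. The slices through `w` need this, as `w` may lie
on an edge of the rectangle. -/
theorem partialX_rect_eq_deriv {p q : ℂ} {t y : ℝ} (ht : t ∈ Ioo p.re q.re)
    (hy : y ∈ Icc p.im q.im) :
    partialX (rect p q) g ⟨t, y⟩ = deriv (fun x => g ⟨x, y⟩) t := by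
  have hmem : (fun x : ℝ => (⟨t, y⟩ : ℂ) + x • (1 : ℂ)) ⁻¹' rect p q ∈ 𝓝 (0 : ℝ) := by
    have hc : ContinuousAt (fun x : ℝ => t + x) 0 := by fun_prop
    have ht' : Icc p.re q.re ∈ 𝓝 (t + 0) := by
      rw [add_zero]
      exact Icc_mem_nhds ht.1 ht.2
    filter_upwards [hc.eventually_mem ht'] with x hx
    exact ⟨by simpa using hx, by simpa using hy⟩
  rw [partialX, lineDerivWithin, derivWithin_of_mem_nhds hmem]
  have : (fun x : ℝ => g ((⟨t, y⟩ : ℂ) + x • (1 : ℂ))) = fun x => (fun x => g ⟨x, y⟩) (t + x) := by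
    funext x
    refine congrArg g (Complex.ext ?_ ?_) <;> simp
  rw [this, deriv_comp_const_add (fun x => g ⟨x, y⟩), add_zero]

theorem partialY_rect_eq_deriv {p q : ℂ} {t x : ℝ} (ht : t ∈ Ioo p.im q.im)
    (hx : x ∈ Icc p.re q.re) :
    partialY (rect p q) g ⟨x, t⟩ = deriv (fun y => g ⟨x, y⟩) t := by
  have hmem : (fun y : ℝ => (⟨x, t⟩ : ℂ) + y • Complex.I) ⁻¹' rect p q ∈ 𝓝 (0 : ℝ) := by
    have hc : ContinuousAt (fun y : ℝ => t + y) 0 := by fun_prop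
    have ht' : Icc p.im q.im ∈ 𝓝 (t + 0) := by
      rw [add_zero]
      exact Icc_mem_nhds ht.1 ht.2
    filter_upwards [hc.eventually_mem ht'] with y hy
    exact ⟨by simpa using hx, by simpa using hy⟩
  rw [partialY, lineDerivWithin, derivWithin_of_mem_nhds hmem]
  have : (fun y : ℝ => g ((⟨x, t⟩ : ℂ) + y • Complex.I)) =
      fun y => (fun y => g ⟨x, y⟩) (t + y) := by
    funext y
    refine congrArg g (Complex.ext ?_ ?_) <;> simp
  rw [this, deriv_comp_const_add (fun y => g ⟨x, y⟩), add_zero]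

end Partial

/-! ### The identity in one coordinate -/

section Coordinate

variable {p q : ℂ} {β₀ β₁ s₀ s₁ : ℝ} {φ l : ℂ → ℝ} {θ ν f : ℂ → ℂ} {w : ℂ}

theorem integrableOn_deriv_propFracIntegral_re (hre : p.re < q.re) (hβ₀ : 0 < β₀)
    (hφ : ContinuousOn φ (rect p q)) (hφx : ∀ z ∈ rect p q, 0 < partialX (rect p q) φ z)
    (hw : w ∈ rect p q)
    (hf : AbsolutelyContinuousOnInterval (fun x => f ⟨x, w.im⟩) p.re q.re) :
    IntegrableOn (deriv (propFracIntegral p.re β₀ s₀ (fun t => φ ⟨t, w.im⟩)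
      (fun t => f ⟨t, w.im⟩))) (Icc p.re q.re) := by
  have hbv := boundedVariationOn_propFracIntegral (s := s₀) hre hβ₀ (ψ := fun t => φ ⟨t, w.im⟩)
    (hφ.comp (f := fun t : ℝ => (⟨t, w.im⟩ : ℂ)) (Continuous.continuousOn
      ((by fun_prop : Continuous fun t : ℝ => (t : ℂ) + w.im * Complex.I).congr fun t => by
        apply Complex.ext <;> simp))
      fun t ht => ⟨ht, hw.2⟩)
    (fun t ht => by
      rw [← partialX_rect_eq_deriv ht hw.2]
      exact hφx _ ⟨Ioo_subset_Icc_self ht, hw.2⟩) hf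
  rw [← uIcc_of_le hre.le] at hbv
  exact (intervalIntegrable_iff_integrableOn_Icc_of_le hre.le).1
    (intervalIntegrable_deriv_of_boundedVariationOn hbv)

theorem integrableOn_deriv_propFracIntegral_im (him : p.im < q.im) (hβ₁ : 0 < β₁)
    (hφ : ContinuousOn φ (rect p q)) (hφy : ∀ z ∈ rect p q, 0 < partialY (rect p q) φ z)
    (hw : w ∈ rect p q)
    (hf : AbsolutelyContinuousOnInterval (fun y => f ⟨w.re, y⟩) p.im q.im) :
    IntegrableOn (deriv (propFracIntegral p.im β₁ s₁ (fun t => φ ⟨w.re, t⟩)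
      (fun t => f ⟨w.re, t⟩))) (Icc p.im q.im) := by
  have hbv := boundedVariationOn_propFracIntegral (s := s₁) him hβ₁ (ψ := fun t => φ ⟨w.re, t⟩)
    (hφ.comp (f := fun t : ℝ => (⟨w.re, t⟩ : ℂ)) (Continuous.continuousOn
      ((by fun_prop : Continuous fun t : ℝ => (w.re : ℂ) + t * Complex.I).congr fun t => by
        apply Complex.ext <;> simp))
      fun t ht => ⟨hw.1, ht⟩)
    (fun t ht => by
      rw [← partialY_rect_eq_deriv ht hw.1]
      exact hφy _ ⟨hw.1, Ioo_subset_Icc_self ht⟩) hf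
  rw [← uIcc_of_le him.le] at hbv
  exact (intervalIntegrable_iff_integrableOn_Icc_of_le him.le).1
    (intervalIntegrable_deriv_of_boundedVariationOn hbv)

/-- `A_{θν} + i B_{θν}` in one coordinate. -/
theorem partial_re_add_partial_im (hθ : ContDiff ℝ 1 θ) (hν : ContDiff ℝ 1 ν) (z : ℂ) :
    ((partialX univ (fun u => (θ u).re) z + partialY univ (fun u => (ν u).re) z : ℝ) : ℂ) +
      ((partialX univ (fun u => (θ u).im) z + partialY univ (fun u => (ν u).im) z : ℝ) : ℂ) *
        Complex.I = fderiv ℝ θ z 1 + fderiv ℝ ν z Complex.I := by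
  have hθd := (hθ.differentiable one_ne_zero z).hasFDerivAt
  have hνd := (hν.differentiable one_ne_zero z).hasFDerivAt
  have h1 : HasFDerivAt (fun u => (θ u).re) _ z := Complex.reCLM.hasFDerivAt.comp z hθd
  have h2 : HasFDerivAt (fun u => (ν u).re) _ z := Complex.reCLM.hasFDerivAt.comp z hνd
  have h3 : HasFDerivAt (fun u => (θ u).im) _ z := Complex.imCLM.hasFDerivAt.comp z hθd
  have h4 : HasFDerivAt (fun u => (ν u).im) _ z := Complex.imCLM.hasFDerivAt.comp z hνd
  rw [partialX_of_mem_nhds univ_mem h1.differentiableAt,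
    partialY_of_mem_nhds univ_mem h2.differentiableAt,
    partialX_of_mem_nhds univ_mem h3.differentiableAt,
    partialY_of_mem_nhds univ_mem h4.differentiableAt, h1.fderiv, h2.fderiv, h3.fderiv, h4.fderiv]
  apply Complex.ext <;> simp

/-- The divergence of `(e^l g θ, e^l g ν)`. -/
theorem planeDiv_exp_mul {g : ℂ → ℂ} {z : ℂ} (hl : DifferentiableAt ℝ l z)
    (hg : DifferentiableAt ℝ g z) (hθ : DifferentiableAt ℝ θ z) (hν : DifferentiableAt ℝ ν z) :
    planeDiv (fun z => (Real.exp (l z) : ℂ) * g z * θ z) (fun z => (Real.exp (l z) : ℂ) * g z * ν z)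
        z =
      (θ z * fderiv ℝ (fun z => (l z : ℂ)) z 1 + ν z * fderiv ℝ (fun z => (l z : ℂ)) z Complex.I) *
          (Real.exp (l z) * g z) +
        Real.exp (l z) * (θ z * fderiv ℝ g z 1 + ν z * fderiv ℝ g z Complex.I) +
        (fderiv ℝ θ z 1 + fderiv ℝ ν z Complex.I) * (Real.exp (l z) * g z) := by
  have hlC : DifferentiableAt ℝ (fun z => (l z : ℂ)) z :=
    Complex.ofRealCLM.differentiableAt.comp z hl
  have hE : HasFDerivAt (fun z => (Real.exp (l z) : ℂ))
      (Complex.exp (l z) • fderiv ℝ (fun z => (l z : ℂ)) z) z := by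
    simpa using hlC.hasFDerivAt.cexp
  have h1 := (hE.mul hg.hasFDerivAt).mul hθ.hasFDerivAt
  have h2 := (hE.mul hg.hasFDerivAt).mul hν.hasFDerivAt
  rw [planeDiv, HasFDerivAt.fderiv (f := fun z => (Real.exp (l z) : ℂ) * g z * θ z) h1,
    HasFDerivAt.fderiv (f := fun z => (Real.exp (l z) : ℂ) * g z * ν z) h2]
  simp only [add_apply, smul_apply, smul_eq_mul,
    Pi.mul_apply, Complex.ofReal_exp]
  ring

/-- With `w` fixed, the fractional integral is a function of `x` plus a function of `y`, so each
partial derivative sees one summand. -/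
theorem partial_fracIntegralCoord {z : ℂ} (hz : z ∈ interior (rect p q)) :
    partialX (rect p q) (fracIntegralCoord p β₀ β₁ s₀ s₁ φ f w) z =
      deriv (propFracIntegral p.re β₀ s₀ (fun t => φ ⟨t, w.im⟩) (fun t => f ⟨t, w.im⟩)) z.re ∧
    partialY (rect p q) (fracIntegralCoord p β₀ β₁ s₀ s₁ φ f w) z =
      deriv (propFracIntegral p.im β₁ s₁ (fun t => φ ⟨w.re, t⟩) (fun t => f ⟨w.re, t⟩)) z.im := by
  rw [interior_rect] at hz
  constructor
  · rw [partialX_rect_eq_deriv hz.1 (Ioo_subset_Icc_self hz.2)]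
    simp only [fracIntegralCoord]
    rw [deriv_add_const]
  · rw [partialY_rect_eq_deriv hz.2 (Ioo_subset_Icc_self hz.1)]
    simp only [fracIntegralCoord]
    rw [deriv_const_add]

/-- One coordinate of the Gauss type identity. -/
theorem gauss_coordinate (hre : p.re < q.re) (him : p.im < q.im) (hβ₀ : 0 < β₀) (hβ₁ : 0 < β₁)
    {m : ℂ} (hm : m ≠ 0) (hφ : ContDiffOn ℝ 1 φ (rect p q))
    (hφpos : ∀ z ∈ rect p q, 0 < partialX (rect p q) φ z ∧ 0 < partialY (rect p q) φ z)
    (hθ : ContDiff ℝ 1 θ) (hν : ContDiff ℝ 1 ν) (hlc : ContinuousOn l (rect p q))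
    (hld : ContDiffOn ℝ 1 l (interior (rect p q)))
    (hl : ∀ z ∈ interior (rect p q),
      θ z * partialX (rect p q) (fun z => (l z : ℂ)) z +
        ν z * partialY (rect p q) (fun z => (l z : ℂ)) z =
      ((partialX (rect p q) φ z + partialY (rect p q) φ z : ℝ) : ℂ) * (m⁻¹ * (1 - m)))
    (hw : w ∈ rect p q)
    (hfx : AbsolutelyContinuousOnInterval (fun x => f ⟨x, w.im⟩) p.re q.re)
    (hfy : AbsolutelyContinuousOnInterval (fun y => f ⟨w.re, y⟩) p.im q.im)
    {g H D : ℂ → ℂ} (hg : g = fracIntegralCoord p β₀ β₁ s₀ s₁ φ f w)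
    (hH : H = fun z => (Real.exp (l z) : ℂ) * g z)
    (hHd : ContDiffOn ℝ 1 H (interior (rect p q))) (hHc : ContinuousOn H (rect p q))
    (hD : ∀ z, D z = (Real.exp (l z) : ℂ) *
        ((partialX (rect p q) φ z + partialY (rect p q) φ z : ℝ) : ℂ) * m⁻¹ *
        ((1 - m) * g z + m * ((θ z * partialX (rect p q) g z + ν z * partialY (rect p q) g z) /
          ((partialX (rect p q) φ z + partialY (rect p q) φ z : ℝ) : ℂ))) +
      ((partialX univ (fun u => (θ u).re) z + partialY univ (fun u => (ν u).re) z : ℝ) : ℂ) * H z +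
      ((partialX univ (fun u => (θ u).im) z + partialY univ (fun u => (ν u).im) z : ℝ) : ℂ) *
        Complex.I * H z)
    {ρ : ℂ → ℂ} (hρ : IsPlaneParam ρ) (hρJ : ρ '' Metric.closedBall 0 1 ⊆ rect p q) :
    IntervalIntegrable (rhoPullback θ ν H (boundaryCurve ρ)) volume 0 (2 * π) ∧
    IntegrableOn D (ρ '' Metric.closedBall 0 1) ∧
    ∫ τ in (0 : ℝ)..(2 * π), rhoPullback θ ν H (boundaryCurve ρ) τ =
      ∫ z in ρ '' Metric.closedBall 0 1, D z := by
  obtain ⟨S, M, hC⟩ := hρ.exists_isC1Curve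
  set J := rect p q with hJ
  have hJc : IsCompact J := isCompact_rect p q
  obtain ⟨c, hc⟩ := nonempty_interior_rect hre him
  have hnhds : ∀ z ∈ interior J, J ∈ 𝓝 z := fun z hz => mem_interior_iff_mem_nhds.1 hz
  have hmemi : ∀ z ∈ interior J, interior J ∈ 𝓝 z := fun z hz => isOpen_interior.mem_nhds hz
  -- Smoothness is assumed only for `H`; it passes to `g = e^{-l} H`.
  have hgd : ∀ z ∈ interior J, DifferentiableAt ℝ g z := by
    intro z hz
    have h1 : DifferentiableAt ℝ H z := (hHd.differentiableOn one_ne_zero).differentiableAt (hmemi z hz)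
    have h2 : DifferentiableAt ℝ (fun z => (Real.exp (-l z) : ℂ)) z :=
      Complex.ofRealCLM.differentiableAt.comp z
        ((hld.differentiableOn one_ne_zero).differentiableAt (hmemi z hz)).neg.exp
    have h3 : g = fun z => (Real.exp (-l z) : ℂ) * H z := by
      funext z
      rw [hH]
      simp only
      rw [← mul_assoc, ← Complex.ofReal_mul, ← Real.exp_add, neg_add_cancel, Real.exp_zero,
        Complex.ofReal_one, one_mul]
    rw [h3]
    exact h2.mul h1
  have hdiv : ∀ z ∈ interior J,
      planeDiv (fun z => H z * θ z) (fun z => H z * ν z) z =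
        ((partialX J φ z + partialY J φ z : ℝ) : ℂ) * (m⁻¹ * (1 - m)) * H z +
        Real.exp (l z) * (θ z * partialX J g z + ν z * partialY J g z) +
        (fderiv ℝ θ z 1 + fderiv ℝ ν z Complex.I) * H z := by
    intro z hz
    have hlz : DifferentiableAt ℝ l z :=
      (hld.differentiableOn one_ne_zero).differentiableAt (hmemi z hz)
    have hlC : DifferentiableAt ℝ (fun z => (l z : ℂ)) z :=
      Complex.ofRealCLM.differentiableAt.comp z hlz
    rw [← hl z hz, partialX_of_mem_nhds (hnhds z hz) hlC, partialY_of_mem_nhds (hnhds z hz) hlC,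
      partialX_of_mem_nhds (hnhds z hz) (hgd z hz), partialY_of_mem_nhds (hnhds z hz) (hgd z hz)]
    simp only [hH]
    exact planeDiv_exp_mul hlz (hgd z hz) (hθ.differentiable one_ne_zero z)
      (hν.differentiable one_ne_zero z)
  -- Positive partial derivatives of `φ` justify cancelling `Dφ`, and `m ≠ 0` cancels `m⁻¹ * m`.
  have hDdiv : ∀ z ∈ interior J, D z = planeDiv (fun z => H z * θ z) (fun z => H z * ν z) z := by
    intro z hz
    have hpos := hφpos z (interior_subset hz)
    have hne : ((partialX J φ z + partialY J φ z : ℝ) : ℂ) ≠ 0 := by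
      exact_mod_cast (add_pos hpos.1 hpos.2).ne'
    rw [hdiv z hz, hD z, ← partial_re_add_partial_im hθ hν z, hH]
    simp only
    field_simp
    ring
  -- The frontier of a convex set is null, so the one-sided derivatives on the edges play no role.
  have hae : ∀ᵐ z, z ∈ J → z ∈ interior J := by
    filter_upwards [compl_mem_ae_iff.2 ((convex_rect p q).addHaar_frontier volume)] with z hz hzJ
    by_contra hn
    exact hz ⟨subset_closure hzJ, hn⟩
  have hEc : ContinuousOn (fun z => (Real.exp (l z) : ℂ)) J :=
    Complex.continuous_ofReal.comp_continuousOn (Real.continuous_exp.comp_continuousOn hlc)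
  -- By `hdiv` the divergence is free of the gradient of `l`. Its terms are functions continuous on
  -- the compact `J` (`i1`, `i2`), and continuous functions times integrable one-variable
  -- derivatives (`i3`, `i4`).
  have hint : IntegrableOn (planeDiv (fun z => H z * θ z) (fun z => H z * ν z)) J := by
    have huniq : UniqueDiffOn ℝ J := uniqueDiffOn_convex (convex_rect p q) ⟨c, hc⟩
    have hφ' := hφ.continuousOn_fderivWithin huniq le_rfl
    have hθ' := hθ.continuous_fderiv one_ne_zero
    have hν' := hν.continuous_fderiv one_ne_zero
    have hu := integrableOn_rect_comp_re (p := p) (q := q)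
      (integrableOn_deriv_propFracIntegral_re (s₀ := s₀) hre hβ₀ hφ.continuousOn
      (fun z hz => (hφpos z hz).1) hw hfx)
    have hv := integrableOn_rect_comp_im (p := p) (q := q)
      (integrableOn_deriv_propFracIntegral_im (s₁ := s₁) him hβ₁ hφ.continuousOn
      (fun z hz => (hφpos z hz).2) hw hfy)
    have i1 : IntegrableOn (fun z =>
        ((fderivWithin ℝ φ J z 1 + fderivWithin ℝ φ J z Complex.I : ℝ) : ℂ) * (m⁻¹ * (1 - m)) * H z)
        J := by
      refine ContinuousOn.integrableOn_compact hJc (ContinuousOn.mul (ContinuousOn.mul ?_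
        continuousOn_const) hHc)
      exact Complex.continuous_ofReal.comp_continuousOn
        ((hφ'.clm_apply continuousOn_const).add (hφ'.clm_apply continuousOn_const))
    have i2 : IntegrableOn (fun z => (fderiv ℝ θ z 1 + fderiv ℝ ν z Complex.I) * H z) J := by
      refine ContinuousOn.integrableOn_compact hJc (ContinuousOn.mul ?_ hHc)
      exact Continuous.continuousOn (by fun_prop)
    have i3 := hu.continuousOn_mul (hEc.mul hθ.continuous.continuousOn) hJc
    have i4 := hv.continuousOn_mul (hEc.mul hν.continuous.continuousOn) hJc
    refine ((i1.add (i3.add i4)).add i2).congr ?_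
    rw [EventuallyEq, ae_restrict_iff' hJc.measurableSet]
    filter_upwards [hae] with z hz hzJ
    have hzi := hz hzJ
    have hφz : DifferentiableAt ℝ φ z :=
      (hφ.differentiableOn one_ne_zero).differentiableAt (hnhds z hzi)
    have hpx := (partial_fracIntegralCoord (β₀ := β₀) (β₁ := β₁) (s₀ := s₀) (s₁ := s₁) (φ := φ)
      (f := f) (w := w) hzi)
    rw [hdiv z hzi, hg, hpx.1, hpx.2, partialX_of_mem_nhds (hnhds z hzi) hφz,
      partialY_of_mem_nhds (hnhds z hzi) hφz]
    simp only [Pi.add_apply, Pi.mul_apply, fderivWithin_of_mem_nhds (hnhds z hzi)]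
    ring
  have hmeas := hρ.isCompact_image.measurableSet
  have haeΛ : ∀ᵐ z, z ∈ ρ '' Metric.closedBall 0 1 →
      planeDiv (fun z => H z * θ z) (fun z => H z * ν z) z = D z := by
    filter_upwards [hae] with z hz hzΛ
    exact (hDdiv z (hz (hρJ hzΛ))).symm
  have hpull : rhoPullback θ ν H (boundaryCurve ρ) =
      fluxPullback (fun z => H z * θ z) (fun z => H z * ν z) (boundaryCurve ρ) := by
    funext τ
    simp only [rhoPullback, fluxPullback]
    ring
  have hV₁ : ContinuousOn (fun z => H z * θ z) J := hHc.mul hθ.continuous.continuousOn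
  have hV₂ : ContinuousOn (fun z => H z * ν z) J := hHc.mul hν.continuous.continuousOn
  refine ⟨?_, ?_, ?_⟩
  · rw [hpull]
    exact hC.intervalIntegrable_fluxPullback
      (fun τ => hρJ (IsPlaneParam.boundaryCurve_mem ρ τ)) hV₁ hV₂
  · exact (hint.mono_set hρJ).congr ((ae_restrict_iff' hmeas).2 haeΛ)
  · rw [hpull, hρ.integral_fluxPullback_of_continuousOn hJc (convex_rect p q) hc hρJ hV₁ hV₂
      (hHd.mul hθ.contDiffOn) (hHd.mul hν.contDiffOn) hint]
    exact setIntegral_congr_ae hmeas haeΛ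

end Coordinate

end BicomplexGauss

/-! ### Assembly of the two idempotent coordinates -/

theorem mainTheorem2
    -- the box `J_P^Q`
    (P Q : BicomplexGauss.Bicomplex)
    (hPQ₁ : P.1.re < Q.1.re ∧ P.1.im < Q.1.im)
    (hPQ₂ : P.2.re < Q.2.re ∧ P.2.im < Q.2.im)
    -- orders and proportions in `(0,1)`
    (α σ : Fin 4 → ℝ)
    (hα : ∀ m, α m ∈ Set.Ioo (0 : ℝ) 1)
    (hσ : ∀ m, σ m ∈ Set.Ioo (0 : ℝ) 1)
    -- the function `φ` with positive values and positive partial derivatives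
    (φ : BicomplexGauss.RealProductFun)
    (hφ₁ : ContDiffOn ℝ 1 φ.1 (BicomplexGauss.rect P.1 Q.1))
    (hφ₂ : ContDiffOn ℝ 1 φ.2 (BicomplexGauss.rect P.2 Q.2))
    (hφpos₁ : ∀ z ∈ BicomplexGauss.rect P.1 Q.1, 0 < φ.1 z ∧
      0 < BicomplexGauss.partialX (BicomplexGauss.rect P.1 Q.1) φ.1 z ∧
      0 < BicomplexGauss.partialY (BicomplexGauss.rect P.1 Q.1) φ.1 z)
    (hφpos₂ : ∀ z ∈ BicomplexGauss.rect P.2 Q.2, 0 < φ.2 z ∧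
      0 < BicomplexGauss.partialX (BicomplexGauss.rect P.2 Q.2) φ.2 z ∧
      0 < BicomplexGauss.partialY (BicomplexGauss.rect P.2 Q.2) φ.2 z)
    -- the weights `ϑ` and `φ` (here `θ` and `ν`)
    (θ ν : BicomplexGauss.ProductFun)
    (hθ : ContDiff ℝ 1 θ.1 ∧ ContDiff ℝ 1 θ.2)
    (hν : ContDiff ℝ 1 ν.1 ∧ ContDiff ℝ 1 ν.2)
    -- the exponents `λ₁, λ₂`
    (l : BicomplexGauss.RealProductFun)
    (hl_cont : ContinuousOn l.1 (BicomplexGauss.rect P.1 Q.1) ∧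
      ContinuousOn l.2 (BicomplexGauss.rect P.2 Q.2))
    (hl_diff : ContDiffOn ℝ 1 l.1 (interior (BicomplexGauss.rect P.1 Q.1)) ∧
      ContDiffOn ℝ 1 l.2 (interior (BicomplexGauss.rect P.2 Q.2)))
    (hl : ∀ Z ∈ interior (BicomplexGauss.box P Q),
      (BicomplexGauss.weightedCR P Q θ ν l.toBicomplex).eval Z =
        (BicomplexGauss.gradSum P Q φ).eval Z *
          ((BicomplexGauss.proportion σ)⁻¹ * (1 - BicomplexGauss.proportion σ)))
    -- `W` and `F`
    (W : BicomplexGauss.Bicomplex) (hW : W ∈ BicomplexGauss.box P Q)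
    (F : BicomplexGauss.ProductFun) (hF : BicomplexGauss.IsAC P Q W F)
    (hG_diff : ContDiffOn ℝ 1
      (BicomplexGauss.expFun l * BicomplexGauss.fracIntegral P α σ φ F W).eval
      (interior (BicomplexGauss.box P Q)))
    (hG_cont : ContinuousOn
      (BicomplexGauss.expFun l * BicomplexGauss.fracIntegral P α σ φ F W).eval
      (BicomplexGauss.box P Q))
    -- the surface `Λ` with boundary `γ`
    (Λ : BicomplexGauss.Surface) (hΛ : Λ.carrier ⊆ BicomplexGauss.box P Q) :
    BicomplexGauss.LineIntegrable Λ θ ν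
      (BicomplexGauss.expFun l * BicomplexGauss.fracIntegral P α σ φ F W) ∧
    BicomplexGauss.SurfaceIntegrable Λ
      (BicomplexGauss.expFun l * BicomplexGauss.gradSum P Q φ *
          BicomplexGauss.constFun (BicomplexGauss.proportion σ)⁻¹ *
          BicomplexGauss.fracCR P Q α σ φ θ ν F W +
        BicomplexGauss.weightA θ ν *
          (BicomplexGauss.expFun l * BicomplexGauss.fracIntegral P α σ φ F W) +
        BicomplexGauss.weightB θ ν * BicomplexGauss.constFun BicomplexGauss.unitI *
          (BicomplexGauss.expFun l * BicomplexGauss.fracIntegral P α σ φ F W)) ∧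
    BicomplexGauss.lineIntegral Λ θ ν
        (BicomplexGauss.expFun l * BicomplexGauss.fracIntegral P α σ φ F W) =
      BicomplexGauss.unitI / 2 *
        BicomplexGauss.surfaceIntegral Λ
          (BicomplexGauss.expFun l * BicomplexGauss.gradSum P Q φ *
              BicomplexGauss.constFun (BicomplexGauss.proportion σ)⁻¹ *
              BicomplexGauss.fracCR P Q α σ φ θ ν F W +
            BicomplexGauss.weightA θ ν *
              (BicomplexGauss.expFun l * BicomplexGauss.fracIntegral P α σ φ F W) +
            BicomplexGauss.weightB θ ν * BicomplexGauss.constFun BicomplexGauss.unitI *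
              (BicomplexGauss.expFun l * BicomplexGauss.fracIntegral P α σ φ F W)) := by
  -- The hypotheses on the four-dimensional box are restricted to one coordinate by freezing the
  -- other at an interior point.
  obtain ⟨z₁, hz₁⟩ := BicomplexGauss.nonempty_interior_rect hPQ₁.1 hPQ₁.2
  obtain ⟨z₂, hz₂⟩ := BicomplexGauss.nonempty_interior_rect hPQ₂.1 hPQ₂.2
  have hi₁ : ∀ z ∈ interior (BicomplexGauss.rect P.1 Q.1),
      ((z, z₂) : BicomplexGauss.Bicomplex) ∈ interior (BicomplexGauss.box P Q) := fun z hz => by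
    rw [BicomplexGauss.box, interior_prod_eq]
    exact ⟨hz, hz₂⟩
  have hi₂ : ∀ z ∈ interior (BicomplexGauss.rect P.2 Q.2),
      ((z₁, z) : BicomplexGauss.Bicomplex) ∈ interior (BicomplexGauss.box P Q) := fun z hz => by
    rw [BicomplexGauss.box, interior_prod_eq]
    exact ⟨hz₁, hz⟩
  have hm₁ : (BicomplexGauss.proportion σ).1 ≠ 0 := fun h =>
    (hσ 0).1.ne' (congrArg Complex.re h)
  have hm₂ : (BicomplexGauss.proportion σ).2 ≠ 0 := fun h =>
    (hσ 2).1.ne' (congrArg Complex.re h)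
  have hβ : ∀ k, 0 < 1 - α k := fun k => sub_pos.2 (hα k).2
  obtain ⟨l₁, a₁, e₁⟩ := BicomplexGauss.gauss_coordinate hPQ₁.1 hPQ₁.2 (hβ 0) (hβ 1) hm₁ hφ₁
    (fun z hz => (hφpos₁ z hz).2) hθ.1 hν.1 hl_cont.1 hl_diff.1
    (fun z hz => congrArg Prod.fst (hl (z, z₂) (hi₁ z hz))) hW.1 hF.1 hF.2.1
    (s₀ := σ 0) (s₁ := σ 1) rfl rfl
    (contDiff_fst.comp_contDiffOn (hG_diff.comp
      (contDiff_id.prodMk contDiff_const).contDiffOn hi₁))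
    (continuous_fst.comp_continuousOn (hG_cont.comp (f := fun z => (z, z₂))
      (continuous_id.prodMk continuous_const).continuousOn
      fun z hz => ⟨hz, interior_subset hz₂⟩))
    (fun z => rfl) Λ.param₁ (by
      rintro _ ⟨u, hu, rfl⟩
      exact (hΛ ⟨u, hu, rfl⟩).1)
  obtain ⟨l₂, a₂, e₂⟩ := BicomplexGauss.gauss_coordinate hPQ₂.1 hPQ₂.2 (hβ 2) (hβ 3) hm₂ hφ₂
    (fun z hz => (hφpos₂ z hz).2) hθ.2 hν.2 hl_cont.2 hl_diff.2
    (fun z hz => congrArg Prod.snd (hl (z₁, z) (hi₂ z hz))) hW.2 hF.2.2.1 hF.2.2.2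
    (s₀ := σ 2) (s₁ := σ 3) rfl rfl
    (contDiff_snd.comp_contDiffOn (hG_diff.comp
      (contDiff_const.prodMk contDiff_id).contDiffOn hi₂))
    (continuous_snd.comp_continuousOn (hG_cont.comp (f := fun z => (z₁, z))
      (continuous_const.prodMk continuous_id).continuousOn
      fun z hz => ⟨interior_subset hz₁, hz⟩))
    (fun z => rfl) Λ.param₂ (by
      rintro _ ⟨u, hu, rfl⟩
      exact (hΛ ⟨u, hu, rfl⟩).2)
  have hI : ∀ x : ℂ, Complex.I / 2 * (-2 * Complex.I * x) = x := fun x => by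
    linear_combination (-x) * Complex.I_mul_I
  refine ⟨⟨l₁, l₂⟩, ⟨a₁, a₂⟩, Prod.ext ?_ ?_⟩
  · exact e₁.trans (hI _).symm
  · exact e₂.trans (hI _).symm
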